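/- **Setting.** Let $1\le k<p$ and let $U\subset\mathbb R^q$ be open. Consider the quasilinear system of $l$ first-order equations $$\mathcal A^{\mu i}{}_{\alpha}(u)\,u^\alpha_i=0,\qquad \mu=1,\dots,l,\tag{1}$$ in $p$ independent variables $x$ and $q$ dependent variables $u$ (summation over repeated indices), with $C^1$ coefficients on $U$. Put $\mathcal A^\mu=(\mathcal A^{\mu i}{}_\alpha)\in\mathbb R^{p\times q}$ and $\mathcal A^i=(\mathcal A^{\mu i}{}_\alpha)\in\mathbb R^{l\times q}$. Assume that the system is hyperbolic in the following sense: there are $C^1$ functions $\lambda^1,\dots,\lambda^k:U\to\mathbb R^p$ whose values are linearly independent at every $u\in U$ and which are real wave vectors, $\ker(\lambda^A_i\mathcal A^i)\neq0$. Let $i_1,\dots,i_k$ be distinct indices such that the block $\Lambda=(\lambda^A_{i_B})$ is invertible on $U$, and let $\tilde\lambda=\Lambda^{-1}\lambda$ be the normalized basis $\tilde\lambda^A=dx^{i_A}+\sum_{i\ne i_1,\dots,i_k}\tilde\lambda^A_i\,dx^i$. Put $r^A(x,u)=\lambda^A_i(u)x^i$, $\tilde r^A(x,u)=\tilde\lambda^A_i(u)x^i$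 and $\eta_i=(\partial\tilde\lambda^A_i/\partial u^\alpha)\in\mathbb R^{k\times q}$. An *orthogonal frame* is a family of $p-k$ pointwise linearly independent $C^1$ vector functions $\xi_a(u)$ on $U$ with $\lambda^A_i\xi^i_a=0$. Put $X_a=\xi^i_a(u)\,\partial/\partial x^i$, with first prolongation $$\mathrm{pr}^{(1)}X_a=X_a-\frac{\partial\xi^i_a}{\partial u^\beta}u^\beta_ju^\alpha_i\frac{\partial}{\partial u^\alpha_j},$$ and let $\mathbb S$ be the set of points $(x,u,u_i)$ of the first jet space with $\mathcal A^iu_i=0$ and $\xi^i_au_i=0$ for all $a$. For $\Omega\subset\mathbb R^p\times U$ open (for example, a neighbourhood of a point $(x_0,u_0)$), the $X_a$ span a *$(p-k)$-dimensional Abelian conditional symmetry algebra* $L$ of (1) over $\Omega$ if $[X_a,X_b]=0$ and $\mathrm{pr}^{(1)}X_a(\mathcal A^iu_i)=0$ at all points of $\mathbb S$ over $\Omega$. For $u\in U$, $F\in\mathbb R^{q\times k}$ and $N\ge0$, the *trace conditions* at $(u,F)$ are $$\mathrm{tr}(\mathcal A^\mu F\tilde\lambda)=0,\qquad \mathrm{tr}\bigl(\mathcal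 A^\mu F\,\eta_{(a_1}F\cdots\eta_{a_s)}F\,\tilde\lambda\bigr)=0,\tag{2}$$ for all $\mu$, all $1\le s\le N$ and all $a_1,\dots,a_s\notin\{i_1,\dots,i_k\}$; round brackets denote symmetrization, and $\mathcal A^\mu,\tilde\lambda,\eta_a$ are taken at $u$. They *hold on $\mathbb S$ over $\Omega$* if, at every point of $\mathbb S$ over $\Omega$ which is the 1-jet of a function given implicitly by $u=f(\tilde r(x,u))$ with $f$ of class $C^1$, they hold for $F=\partial f/\partial r$; that is, whenever at this point $$u=f(\tilde r),\qquad \det\Bigl(I_q-\frac{\partial f}{\partial r}\frac{\partial\tilde r}{\partial u}\Bigr)\ne0,\qquad (u^\alpha_i)=\Bigl(I_q-\frac{\partial f}{\partial r}\frac{\partial\tilde r}{\partial u}\Bigr)^{-1}\frac{\partial f}{\partial r}\tilde\lambda.$$ **Proposition.** Let $N=k-1$ or $N=q-1$ (either choice). 1. Let $\Omega\subset\mathbb R^p\times U$ be open. System (1) admits over $\Omega$ a $(p-k)$-dimensional Abelian conditional symmetry algebra spanned by the $X_a$ of some orthogonal frame if and only if there is an orthogonal frame for which the trace conditions (2) hold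 on $\mathbb S$ over $\Omega$. Moreover, for every given orthogonal frame, the $X_a$ span such an algebra if and only if the trace conditions hold on $\mathbb S$ over $\Omega$. 2. Let $\xi_a$ be an orthogonal frame, and let $u(x)$ be a $C^1$ solution of (1) near $x=0$ with $u(0)\in U$. Then the graph of $u$ is invariant under the $X_a$ near $x=0$ (each $X_a$ is tangent to it) if and only if there is an $f$, of class $C^1$ near $0\in\mathbb R^k$, such that near $x=0$ $$u=f(r^1,\dots,r^k),\qquad r^A=\lambda^A_i(u)x^i.\tag{3}$$ 3. If a $C^1$ function $u(x)$ with $u(0)\in U$ has the form (3) near $x=0$ with $f$ of class $C^1$ near $0$, then, for all $x$ near $0$, the rank of the Jacobi matrix of $u$ at $x$ equals the rank of $\partial f/\partial r$ at $r(x,u(x))$. In particular it is at most $k$, and it is $k$ exactly where $\partial f/\partial r$ has rank $k$. 4. If a $C^1$ function $u(x)$ with $u(0)\in U$ satisfies $u=f(\tilde r(x,u))$ near $x=0$ with $f$ of class $C^1$ near $0$, then $u$ solves (1) near $x=0$ if and only if the trace conditions (2) hold at $(f(r),\partial f/\partial r(r))$ for all $r$ near $0$. -/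

import Mathlib

open Filter Topology

namespace RankK

/-- Points `(x, u, u_i)` of the first jet space; the entry `j.2.2 α i` is the coordinate `u^α_i`. -/
abbrev Jet (p q : ℕ) : Type := (Fin p → ℝ) × (Fin q → ℝ) × (Fin q → Fin p → ℝ)

/-- The Jacobi matrix `(∂g^α/∂y^i)` of a map `g : ℝ^m → ℝ^n`. -/
noncomputable def jac {m n : ℕ} (g : (Fin m → ℝ) → (Fin n → ℝ)) (y : Fin m → ℝ) :
    Matrix (Fin n) (Fin m) ℝ :=
  Matrix.of fun α i => fderiv ℝ g y (Pi.single i 1) α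

/-- The 1-jet at `x` of a function `u(x)`. -/
noncomputable def jet {p q : ℕ} (u : (Fin p → ℝ) → (Fin q → ℝ)) (x : Fin p → ℝ) : Jet p q :=
  (x, u x, fun α i => jac u x α i)

/-- The left-hand side of the `μ`-th equation of the system, as a function on the jet space:
`A^{μ i}_α(u) u^α_i`, with `a u μ i α = A^{μ i}_α(u)`. -/
def eqn {p q l : ℕ} (a : (Fin q → ℝ) → Fin l → Fin p → Fin q → ℝ) (μ : Fin l)
    (j : Jet p q) : ℝ :=
  ∑ i, ∑ α, a j.2.1 μ i α * j.2.2 α i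

/-- `u` is a solution of the system `A^{μ i}_α(u) u^α_i = 0` near `x = 0`. -/
def IsSolution {p q l : ℕ} (a : (Fin q → ℝ) → Fin l → Fin p → Fin q → ℝ)
    (u : (Fin p → ℝ) → (Fin q → ℝ)) : Prop :=
  ∀ᶠ x in 𝓝 (0 : Fin p → ℝ), ∀ μ, eqn a μ (jet u x) = 0

/-- The covectors `λ^A(u)` are real wave vectors: `ker (λ^A_i A^i(u)) ≠ 0` for every `A`,
at every `u ∈ U`. -/
def AreWaveVectors {p q k l : ℕ} (a : (Fin q → ℝ) → Fin l → Fin p → Fin q → ℝ)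
    (lam : (Fin q → ℝ) → Fin k → Fin p → ℝ) (U : Set (Fin q → ℝ)) : Prop :=
  ∀ u ∈ U, ∀ A, ∃ γ : Fin q → ℝ, γ ≠ 0 ∧ ∀ μ, ∑ i, ∑ α, lam u A i * a u μ i α * γ α = 0

/-- The functions `r^A(x, u) = λ^A_i(u) x^i`. -/
def riem {p q k : ℕ} (lam : (Fin q → ℝ) → Fin k → Fin p → ℝ) (x : Fin p → ℝ)
    (u : Fin q → ℝ) : Fin k → ℝ :=
  fun A => ∑ i, lam u A i * x i

/-- The `k × k` block `Λ = (λ^A_{i_B}(u))` of the columns selected by `ι B = i_B`. -/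
def block {p q k : ℕ} (lam : (Fin q → ℝ) → Fin k → Fin p → ℝ) (ι : Fin k ↪ Fin p)
    (u : Fin q → ℝ) : Matrix (Fin k) (Fin k) ℝ :=
  Matrix.of fun A B => lam u A (ι B)

/-- The basis `Λ⁻¹ λ` of the span of the `λ^A(u)`; it has the form
`dx^{i_A} + ∑_{i ≠ i_1, …, i_k} (Λ⁻¹ λ)^A_i dx^i`. -/
noncomputable def normalized {p q k : ℕ} (lam : (Fin q → ℝ) → Fin k → Fin p → ℝ)
    (ι : Fin k ↪ Fin p) (u : Fin q → ℝ) : Fin k → Fin p → ℝ :=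
  fun A i => ((block lam ι u)⁻¹ * Matrix.of (lam u)) A i

/-- The vector fields `X_a = ξ^i_a(u) ∂/∂x^i` on `X × U`. -/
def vf {p q n : ℕ} (ξ : (Fin q → ℝ) → Fin n → Fin p → ℝ) (a : Fin n)
    (z : (Fin p → ℝ) × (Fin q → ℝ)) : (Fin p → ℝ) × (Fin q → ℝ) :=
  (ξ z.2 a, 0)

/-- The vector fields `ξ_1, …, ξ_n` (of class `C¹` on `U`) are pointwise linearly independent
and orthogonal to the wave vectors, `λ^A_i ξ^i_a = 0`. -/
structure IsOrthogonalFrame {p q k n : ℕ} (lam : (Fin q → ℝ) → Fin k → Fin p → ℝ)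
    (U : Set (Fin q → ℝ)) (ξ : (Fin q → ℝ) → Fin n → Fin p → ℝ) : Prop where
  contDiffOn : ContDiffOn ℝ 1 ξ U
  linearIndependent : ∀ u ∈ U, LinearIndependent ℝ (ξ u)
  orthogonal : ∀ u ∈ U, ∀ A a, ∑ i, lam u A i * ξ u a i = 0

/-- The first prolongation
`pr⁽¹⁾ X_a = X_a - (∂ξ^i_a/∂u^β) u^β_j u^α_i ∂/∂u^α_j`, a vector field on the jet space. -/
noncomputable def prolong {p q n : ℕ} (ξ : (Fin q → ℝ) → Fin n → Fin p → ℝ) (a : Fin n)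
    (j : Jet p q) : Jet p q :=
  (ξ j.2.1 a, 0, fun α m => -∑ i, ∑ β, jac (fun v => ξ v a) j.2.1 i β * j.2.2 β m * j.2.2 α i)

/-- The part of the subvariety `𝕊 = 𝕊_Δ ∩ 𝕊_Q` of the jet space that lies over `Ω ⊆ X × U`:
`A^{μ i}_α(u) u^α_i = 0` and `ξ^i_a(u) u^α_i = 0`. -/
def variety {p q n l : ℕ} (a : (Fin q → ℝ) → Fin l → Fin p → Fin q → ℝ)
    (ξ : (Fin q → ℝ) → Fin n → Fin p → ℝ) (Ω : Set ((Fin p → ℝ) × (Fin q → ℝ))) :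
    Set (Jet p q) :=
  {j | (j.1, j.2.1) ∈ Ω ∧ (∀ μ, eqn a μ j = 0) ∧ ∀ b α, ∑ i, ξ j.2.1 b i * j.2.2 α i = 0}

/-- The vector fields `X_a = ξ^i_a(u) ∂/∂x^i` span over `Ω` an Abelian conditional symmetry
algebra of the system: they commute, and `pr⁽¹⁾ X_b (A^i u_i) = 0` on `𝕊`. -/
structure IsCondSymAlgebra {p q n l : ℕ} (a : (Fin q → ℝ) → Fin l → Fin p → Fin q → ℝ)
    (ξ : (Fin q → ℝ) → Fin n → Fin p → ℝ) (Ω : Set ((Fin p → ℝ) × (Fin q → ℝ))) : Prop where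
  commute : ∀ b c, ∀ z ∈ Ω, VectorField.lieBracket ℝ (vf ξ b) (vf ξ c) z = 0
  symmetry : ∀ j ∈ variety a ξ Ω, ∀ b μ, fderiv ℝ (eqn a μ) j (prolong ξ b j) = 0

/-- The trace conditions at a point `u` for a matrix `F` (the value of `∂f/∂r`), with `η_i`
the matrix `(∂λ^A_i/∂u^α)`, for `i` different from `i_1, …, i_k`:
`tr (A^μ F λ) = 0` and `tr (A^μ F η_{(a_1} F … η_{a_s)} F λ) = 0` for `1 ≤ s ≤ N`.
Here `lam` is meant to be a basis in normalized form, `λ^A_{i_B} = δ^A_B`. -/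
def TraceAt {p q k l : ℕ} (a : (Fin q → ℝ) → Fin l → Fin p → Fin q → ℝ)
    (lam : (Fin q → ℝ) → Fin k → Fin p → ℝ) (ι : Fin k ↪ Fin p) (N : ℕ)
    (u : Fin q → ℝ) (F : Matrix (Fin q) (Fin k) ℝ) : Prop :=
  (∀ μ, (Matrix.of (a u μ) * F * Matrix.of (lam u)).trace = 0) ∧
  ∀ s : ℕ, 1 ≤ s → s ≤ N → ∀ (c : Fin s → {i : Fin p // i ∉ Set.range ι}) (μ : Fin l),
    ∑ σ : Equiv.Perm (Fin s),
      (Matrix.of (a u μ) * F *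
        (List.ofFn fun t => jac (fun v A => lam v A (c (σ t))) u * F).prod *
        Matrix.of (lam u)).trace = 0

/-- The 1-jet `j = (x, u, u_i)` is the 1-jet of the function defined implicitly by
`u = f(r(x, u))`, `r^A = λ^A_i(u) x^i`: one has `u = f(r)`, the matrix
`I - (∂f/∂r)(∂r/∂u)` is invertible and `(u^α_i) = (I - (∂f/∂r)(∂r/∂u))⁻¹ (∂f/∂r) λ`. -/
def GeneratesJet {p q k : ℕ} (lam : (Fin q → ℝ) → Fin k → Fin p → ℝ)
    (f : (Fin k → ℝ) → (Fin q → ℝ)) (j : Jet p q) : Prop :=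
  ContDiffAt ℝ 1 f (riem lam j.1 j.2.1) ∧ f (riem lam j.1 j.2.1) = j.2.1 ∧
  (1 - jac f (riem lam j.1 j.2.1) * jac (fun v => riem lam j.1 v) j.2.1).det ≠ 0 ∧
  Matrix.of j.2.2 =
    (1 - jac f (riem lam j.1 j.2.1) * jac (fun v => riem lam j.1 v) j.2.1)⁻¹ *
      jac f (riem lam j.1 j.2.1) * Matrix.of (lam j.2.1)

/-- The trace conditions hold on `𝕊` over `Ω`: they hold for `∂f/∂r` at every point of `𝕊` over
`Ω`, whenever the point is the 1-jet of a function given implicitly by `u = f(r(x, u))`. -/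
def TraceConditions {p q k n l : ℕ} (a : (Fin q → ℝ) → Fin l → Fin p → Fin q → ℝ)
    (lam : (Fin q → ℝ) → Fin k → Fin p → ℝ) (ι : Fin k ↪ Fin p) (N : ℕ)
    (ξ : (Fin q → ℝ) → Fin n → Fin p → ℝ) (Ω : Set ((Fin p → ℝ) × (Fin q → ℝ))) : Prop :=
  ∀ j ∈ variety a ξ Ω, ∀ f : (Fin k → ℝ) → (Fin q → ℝ), GeneratesJet lam f j →
    TraceAt a lam ι N j.2.1 (jac f (riem lam j.1 j.2.1))

/-- Near `x = 0` the graph of `u` is invariant under the vector fields `X_a`: each `X_a` is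
tangent to the graph, that is, at `(x, u(x))` it is of the form `(v, Du(x) v)`. -/
def GraphInvariant {p q n : ℕ} (ξ : (Fin q → ℝ) → Fin n → Fin p → ℝ)
    (u : (Fin p → ℝ) → (Fin q → ℝ)) : Prop :=
  ∀ᶠ x in 𝓝 (0 : Fin p → ℝ), ∀ b, ∃ v : Fin p → ℝ, vf ξ b (x, u x) = (v, fderiv ℝ u x v)

/-- Near `x = 0` the function `u` is given implicitly by `u = f(r^1, …, r^k)`,
`r^A = λ^A_i(u) x^i`, with `f` of class `C¹` near `r = 0`. -/
def HasImplicitForm {p q k : ℕ} (lam : (Fin q → ℝ) → Fin k → Fin p → ℝ)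
    (f : (Fin k → ℝ) → (Fin q → ℝ)) (u : (Fin p → ℝ) → (Fin q → ℝ)) : Prop :=
  ContDiffAt ℝ 1 f 0 ∧ ∀ᶠ x in 𝓝 (0 : Fin p → ℝ), u x = f (riem lam x (u x))

end RankK

/-!
Write `λ̃` for the normalized wave vectors, `η_b = ∂λ̃_b/∂u`, and let `V` (`traceKer`) be the space
of all `q × k` matrices `G` with `tr (A^μ G λ̃) = 0` for all `μ`. Rows annihilated by an orthogonal
frame are combinations of the rows of `λ̃` (`eq_sum_normalized_of_frame`), so the points of `𝕊` are
the jets with first derivatives `G λ̃`, `G ∈ V`.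

*Symmetries.* Differentiating `λ̃ ξ_a = 0` turns `pr⁽¹⁾ X_a (A^i u_i) = 0` into the statement that
`G η_b G ∈ V` for all `G ∈ V` and all `b` (`isCondSymAlgebra_iff`). On the other side, the jet of a
function `u = f(r̃)` with `∂f/∂r = F` has `G = (1 - F η)⁻¹ F`, where `η = ∑ x^b η_b`, and by
polarization (`traceAt_iff`) the trace conditions say that `F (η' F)ˢ ∈ V` for all `s ≤ N` and all
combinations `η'` of the `η_b` (`traceConditions_iff`). If `V` is closed under `G ↦ G η_b G`, then
polarization gives `G (η G)ˢ ∈ V`, hence `F = G (1 + η G)⁻¹ ∈ V` since the inverse is a polynomial,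
and then `F (η' F)ˢ ∈ V`. Conversely, `F = (1 + t G η)⁻¹ t G` is admissible for `G ∈ V` and small
`t`, and `t⁻² F η_b F ∈ V` tends to `G η_b G`.

*Implicit form.* If `u = f(r(x, u))`, then `(1 - (∂f/∂r)(∂r/∂u)) du = (∂f/∂r) λ` with an invertible
matrix near `x = 0` (`HasImplicitForm.eventually_jac`), which gives the invariance of the graph and
the rank of `du`. Conversely, invariance means that `du` vanishes on the kernel of `λ(u)`, which is
the kernel of `dr`, so that `u` is a function of `r` (`exists_eventually_eq_comp`).

*Solutions.* For `u = f(r̃)` the system says `F (1 - η F)⁻¹ ∈ V`, where `r` and the coefficients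
`x^b` of `η` are independent local coordinates. Replacing `η` by `t η` and letting `t → 0` repeatedly
extracts `F (η F)ˢ ∈ V` for all `s` (`mul_pow_mem_of_eventually_resolvent_mem`); conversely the
inverse is a polynomial in `η F`, and Cayley–Hamilton for `η F` or `F η` reduces all powers to those
with `s ≤ k - 1` or `s ≤ q - 1`.
-/

namespace RankK

/-! ### Matrix polynomials, resolvents and polarization -/

open Polynomial in
/-- By Cayley–Hamilton the powers of exponent `< n` of an `n × n` matrix span all its powers; this
is what bounds the number of trace conditions. -/
theorem map_aeval_mem_of_map_pow_mem {n : ℕ} {E : Type*} [AddCommGroup E] [Module ℝ E]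
    (φ : Matrix (Fin n) (Fin n) ℝ →ₗ[ℝ] E) (V : Submodule ℝ E) (M : Matrix (Fin n) (Fin n) ℝ)
    (h : ∀ s < n, φ (M ^ s) ∈ V) (P : ℝ[X]) : φ (aeval M P) ∈ V := by
  rw [Matrix.aeval_eq_aeval_mod_charpoly, aeval_eq_sum_range, map_sum]
  refine Submodule.sum_mem _ fun s _ => ?_
  rw [map_smul]
  by_cases hs : s < n
  · exact V.smul_mem _ (h s hs)
  · have : (P %ₘ M.charpoly).coeff s = 0 := by
      refine coeff_eq_zero_of_degree_lt ((degree_modByMonic_lt P M.charpoly_monic).trans_le ?_)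
      rw [Matrix.charpoly_degree_eq_dim, Fintype.card_fin]
      exact_mod_cast not_lt.mp hs
    simp [this]

open Polynomial in
/-- The inverse of `1 - M` is a polynomial in `M`: evaluate `M.charpoly = det (1 - M) + (X - 1) Q`
at `M`. -/
theorem exists_aeval_eq_one_sub_inv {n : ℕ} (M : Matrix (Fin n) (Fin n) ℝ)
    (h : (1 - M).det ≠ 0) : ∃ P : ℝ[X], (1 - M)⁻¹ = aeval M P := by
  have h1 : M.charpoly.eval 1 = (1 - M).det := by
    rw [Matrix.eval_charpoly]; simp
  obtain ⟨Q, hQ⟩ : (X - C 1 : ℝ[X]) ∣ M.charpoly - C (M.charpoly.eval 1) :=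
    X_sub_C_dvd_sub_C_eval
  have h2 := congrArg (aeval M) hQ
  rw [map_sub, Matrix.aeval_self_charpoly, h1, map_mul, map_sub, aeval_X, aeval_C, aeval_C,
    map_one, Algebra.algebraMap_eq_smul_one] at h2
  refine ⟨C ((1 - M).det⁻¹) * Q, Matrix.inv_eq_right_inv ?_⟩
  have h3 : (1 - M) * aeval M Q = (1 - M).det • 1 := by
    have : (1 - M) * aeval M Q = -((M - 1) * aeval M Q) := by rw [← neg_mul, neg_sub]
    rw [this, ← h2]; simp
  rw [map_mul, aeval_C, Algebra.algebraMap_eq_smul_one, smul_mul_assoc, one_mul,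
    Matrix.mul_smul, h3, smul_smul, inv_mul_cancel₀ h, one_smul]

theorem eventually_det_one_sub_smul_ne_zero {n : ℕ} (M : Matrix (Fin n) (Fin n) ℝ) :
    ∀ᶠ t : ℝ in 𝓝 0, (1 - t • M).det ≠ 0 := by
  have hc : Continuous fun t : ℝ => (1 - t • M).det :=
    Continuous.matrix_det (by fun_prop)
  refine hc.continuousAt.eventually_ne ?_
  simp

theorem tendsto_one_sub_smul_inv {n : ℕ} (M : Matrix (Fin n) (Fin n) ℝ) :
    Tendsto (fun t : ℝ => (1 - t • M)⁻¹) (𝓝 0) (𝓝 1) := by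
  have hc : Continuous fun t : ℝ => (1 - t • M) := by fun_prop
  have h : ContinuousAt (fun t : ℝ => (1 - t • M)⁻¹) 0 := by
    simp only [Matrix.inv_def, Ring.inverse_eq_inv']
    have h1 : ContinuousAt (fun t : ℝ => ((1 - t • M).det)⁻¹) 0 :=
      hc.matrix_det.continuousAt.inv₀ (by simp)
    have h2 : ContinuousAt (fun t : ℝ => (1 - t • M).adjugate) 0 :=
      hc.matrix_adjugate.continuousAt
    exact h1.smul h2
  simpa [ContinuousAt] using h

/-- The coefficients of the resolvent series `∑ tˢ Mˢ` are recovered from the values of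
`(1 - t M)⁻¹` at small `t` by taking limits, which stay in a (closed) subspace. -/
theorem mul_pow_mem_of_eventually_resolvent_mem {m n : ℕ}
    (V : Submodule ℝ (Matrix (Fin m) (Fin n) ℝ))
    (F : Matrix (Fin m) (Fin n) ℝ) (M : Matrix (Fin n) (Fin n) ℝ)
    (h : ∀ᶠ t : ℝ in 𝓝 0, F * (1 - t • M)⁻¹ ∈ V) (s : ℕ) : F * M ^ s ∈ V := by
  have hl : ∀ s, Tendsto (fun t : ℝ => F * M ^ s * (1 - t • M)⁻¹) (𝓝[≠] 0)
      (𝓝 (F * M ^ s)) := by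
    intro s
    have h1 : Continuous fun X : Matrix (Fin n) (Fin n) ℝ => F * M ^ s * X := by fun_prop
    simpa [Function.comp_def] using
      (h1.tendsto 1).comp ((tendsto_one_sub_smul_inv M).mono_left nhdsWithin_le_nhds)
  suffices H : ∀ s, ∀ᶠ t : ℝ in 𝓝[≠] 0, F * M ^ s * (1 - t • M)⁻¹ ∈ V by
    exact (Submodule.closed_of_finiteDimensional V).mem_of_tendsto (hl s) (H s)
  intro s
  induction s with
  | zero => simpa using h.filter_mono nhdsWithin_le_nhds
  | succ s ih =>
    have hs : F * M ^ s ∈ V :=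
      (Submodule.closed_of_finiteDimensional V).mem_of_tendsto (hl s) ih
    filter_upwards [ih, self_mem_nhdsWithin,
      (eventually_det_one_sub_smul_ne_zero M).filter_mono nhdsWithin_le_nhds] with t ht ht0 hdet
    have h0 : (1 - t • M) * (1 - t • M)⁻¹ = 1 :=
      Matrix.mul_nonsing_inv _ (isUnit_iff_ne_zero.mpr hdet)
    have h1 : t • (M * (1 - t • M)⁻¹) = (1 - t • M)⁻¹ - 1 := by
      rw [sub_mul, one_mul, Matrix.smul_mul, sub_eq_iff_eq_add'] at h0
      exact eq_sub_of_add_eq h0.symm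
    have h2 : F * M ^ (s + 1) * (1 - t • M)⁻¹
        = t⁻¹ • (F * M ^ s * (1 - t • M)⁻¹ - F * M ^ s) := by
      have : F * M ^ s * (1 - t • M)⁻¹ - F * M ^ s
          = t • (F * M ^ (s + 1) * (1 - t • M)⁻¹) := by
        rw [pow_succ, ← Matrix.mul_assoc, Matrix.mul_assoc (F * M ^ s) M, ← Matrix.mul_smul, h1,
          Matrix.mul_sub, Matrix.mul_one]
      rw [this, smul_smul, inv_mul_cancel₀ ht0, one_smul]
    rw [h2]
    exact V.smul_mem _ (V.sub_mem ht hs)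

theorem continuous_multilinearMap_pi {κ : Type*} [Fintype κ] {s : ℕ}
    (T : MultilinearMap ℝ (fun _ : Fin s => (κ → ℝ)) ℝ) : Continuous T := by
  classical
  have h : ⇑T = fun m => ∑ c : Fin s → κ,
      (∏ t, m t (c t)) * T (fun t => Pi.single (c t) (1 : ℝ)) := by
    funext m
    have hm : m = fun t => ∑ b, m t b • Pi.single b (1 : ℝ) :=
      funext fun t => pi_eq_sum_univ' (m t)
    conv_lhs => rw [hm, T.map_sum]
    simp [T.map_smul_univ]
  rw [h]
  fun_prop

/-- The symmetrization of a multilinear form is the iterated derivative of its restriction to the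
diagonal. -/
theorem multilinear_sum_perm_eq_zero_of_diagonal {κ : Type*} [Fintype κ] {s : ℕ}
    (T : MultilinearMap ℝ (fun _ : Fin s => (κ → ℝ)) ℝ) (h : ∀ w, T (fun _ => w) = 0)
    (v : Fin s → κ → ℝ) : ∑ σ : Equiv.Perm (Fin s), T (fun i => v (σ i)) = 0 := by
  let T' : ContinuousMultilinearMap ℝ (fun _ : Fin s => (κ → ℝ)) ℝ :=
    ⟨T, continuous_multilinearMap_pi T⟩
  have h1 := T'.iteratedFDeriv_comp_diagonal (0 : κ → ℝ) v
  have h2 : (fun x : κ → ℝ => T' fun _ => x) = fun _ => 0 := funext h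
  rw [h2] at h1
  have h3 : iteratedFDeriv ℝ s (fun _ : κ → ℝ => (0 : ℝ)) 0 v = 0 := by
    rw [iteratedFDeriv_fun_zero]; rfl
  rw [h3] at h1
  exact h1.symm

/-- Polarization: a multilinear form vanishes on the diagonal of the span of the `e b` exactly when
all its symmetrizations at tuples of the `e b` vanish. -/
theorem multilinear_diagonal_eq_zero_iff {κ E : Type*} [Fintype κ] [AddCommGroup E] [Module ℝ E]
    {s : ℕ} (T : MultilinearMap ℝ (fun _ : Fin s => E) ℝ) (e : κ → E) :
    (∀ w : κ → ℝ, T (fun _ => ∑ b, w b • e b) = 0) ↔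
      ∀ c : Fin s → κ, ∑ σ : Equiv.Perm (Fin s), T (fun t => e (c (σ t))) = 0 := by
  classical
  constructor
  · intro h c
    let T' := T.compLinearMap fun _ => Fintype.linearCombination ℝ e
    have h1 := multilinear_sum_perm_eq_zero_of_diagonal T'
      (fun w => by simpa [T', Fintype.linearCombination_apply] using h w)
      (fun t => Pi.single (c t) 1)
    simpa [T', Fintype.linearCombination_apply_single] using h1
  · intro h w
    have h1 : T (fun _ => ∑ b, w b • e b)
        = ∑ c : Fin s → κ, (∏ t, w (c t)) * T (fun t => e (c t)) := by
      rw [T.map_sum]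
      simp [T.map_smul_univ]
    have h2 : ∀ σ : Equiv.Perm (Fin s), T (fun _ => ∑ b, w b • e b)
        = ∑ c : Fin s → κ, (∏ t, w (c t)) * T (fun t => e (c (σ t))) := by
      intro σ
      rw [h1, ← (Equiv.arrowCongr σ.symm (Equiv.refl κ)).sum_comp]
      refine Finset.sum_congr rfl fun c _ => ?_
      simp only [Equiv.arrowCongr_apply, Equiv.symm_symm, Equiv.coe_refl, Function.comp, id]
      rw [Equiv.prod_comp σ (fun t => w (c t))]
    have h3 : ∑ σ : Equiv.Perm (Fin s), T (fun _ => ∑ b, w b • e b) = 0 := by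
      rw [Finset.sum_congr rfl fun σ _ => h2 σ, Finset.sum_comm]
      refine Finset.sum_eq_zero fun c _ => ?_
      rw [← Finset.mul_sum, h c, mul_zero]
    rw [Finset.sum_const, nsmul_eq_mul, mul_eq_zero] at h3
    refine h3.resolve_left ?_
    simp [Fintype.card_perm, Nat.factorial_ne_zero]

/-- Polarizing `G ↦ G N G` at `G` and `H = G (N G)ˢ` gives `2 G (N G)ˢ⁺¹ ∈ V`. -/
theorem mul_pow_mem_of_quadratic {m n : ℕ} (V : Submodule ℝ (Matrix (Fin m) (Fin n) ℝ))
    (N : Matrix (Fin n) (Fin m) ℝ) (h : ∀ G ∈ V, G * N * G ∈ V)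
    {G : Matrix (Fin m) (Fin n) ℝ} (hG : G ∈ V) (s : ℕ) : G * (N * G) ^ s ∈ V := by
  induction s with
  | zero => simpa using hG
  | succ s ih =>
    set H := G * (N * G) ^ s with hH
    have h1 := V.sub_mem (V.sub_mem (h _ (V.add_mem hG ih)) (h _ hG)) (h _ ih)
    have h2 : (G + H) * N * (G + H) - G * N * G - H * N * H = G * N * H + H * N * G := by
      simp only [Matrix.add_mul, Matrix.mul_add]; abel
    have h3 : G * N * H = G * (N * G) ^ (s + 1) := by
      rw [hH, pow_succ']; simp only [Matrix.mul_assoc]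
    have h4 : H * N * G = G * (N * G) ^ (s + 1) := by
      rw [hH, pow_succ]; simp only [Matrix.mul_assoc]
    rw [h2, h3, h4, ← two_smul ℝ] at h1
    simpa using V.smul_mem (2⁻¹ : ℝ) h1

/-- The push-through identity `(1 - F N)⁻¹ F = F (1 - N F)⁻¹`. -/
theorem one_sub_mul_inv_mul {m n : ℕ} (F : Matrix (Fin m) (Fin n) ℝ)
    (N : Matrix (Fin n) (Fin m) ℝ) (h : (1 - F * N).det ≠ 0) :
    (1 - F * N)⁻¹ * F = F * (1 - N * F)⁻¹ := by
  have h' : (1 - N * F).det ≠ 0 := by rwa [← Matrix.det_one_sub_mul_comm]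
  have h1 : F * (1 - N * F) = (1 - F * N) * F := by
    simp only [Matrix.mul_sub, Matrix.sub_mul, Matrix.mul_one, Matrix.one_mul, Matrix.mul_assoc]
  calc (1 - F * N)⁻¹ * F = (1 - F * N)⁻¹ * (F * (1 - N * F)) * (1 - N * F)⁻¹ := by
        rw [Matrix.mul_assoc, Matrix.mul_assoc, Matrix.mul_nonsing_inv _
          (isUnit_iff_ne_zero.mpr h'), Matrix.mul_one]
    _ = F * (1 - N * F)⁻¹ := by
        rw [h1, ← Matrix.mul_assoc, Matrix.nonsing_inv_mul _ (isUnit_iff_ne_zero.mpr h),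
          Matrix.one_mul]

/-! ### The algebra of the trace conditions -/

/-- The space of all `F` with `tr (A^μ F λ) = 0` for every `μ`, that is, of the `F` for which the
first derivatives `F λ` satisfy the system at a given point. -/
def traceKer {p q k l : ℕ} (A : Fin l → Matrix (Fin p) (Fin q) ℝ)
    (L : Matrix (Fin k) (Fin p) ℝ) : Submodule ℝ (Matrix (Fin q) (Fin k) ℝ) where
  carrier := {F | ∀ μ, (A μ * F * L).trace = 0}
  add_mem' h1 h2 μ := by simp [Matrix.mul_add, Matrix.add_mul, h1 μ, h2 μ]
  zero_mem' μ := by simp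
  smul_mem' t F h μ := by simp [h μ]

theorem mem_traceKer {p q k l : ℕ} {A : Fin l → Matrix (Fin p) (Fin q) ℝ}
    {L : Matrix (Fin k) (Fin p) ℝ} {F : Matrix (Fin q) (Fin k) ℝ} :
    F ∈ traceKer A L ↔ ∀ μ, (A μ * F * L).trace = 0 := Iff.rfl

/-- The combination `∑ w^b η_b` over the indices `b` different from `i_1, …, i_k`, where
`η_b = (∂λ^A_b/∂u^α)`. -/
noncomputable def etaComb {p q k : ℕ} (lam : (Fin q → ℝ) → Fin k → Fin p → ℝ) (ι : Fin k ↪ Fin p)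
    (u : Fin q → ℝ) (w : {i : Fin p // i ∉ Set.range ι} → ℝ) : Matrix (Fin k) (Fin q) ℝ :=
  ∑ b, w b • jac (fun v A => lam v A b) u

/-- The symmetrized trace conditions of order `s` are the polarization of the condition that
`F (η F)ˢ` satisfies the system for every combination `η` of the `η_b`. -/
theorem forall_mul_pow_mem_traceKer_iff {p q k l : ℕ} {κ : Type*} [Fintype κ]
    (A : Fin l → Matrix (Fin p) (Fin q) ℝ)
    (L : Matrix (Fin k) (Fin p) ℝ) (F : Matrix (Fin q) (Fin k) ℝ)
    (η : κ → Matrix (Fin k) (Fin q) ℝ) (s : ℕ) :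
    (∀ w : κ → ℝ, F * ((∑ b, w b • η b) * F) ^ s ∈ traceKer A L) ↔
      ∀ (c : Fin s → κ) (μ : Fin l), ∑ σ : Equiv.Perm (Fin s),
        (A μ * F * (List.ofFn fun t => η (c (σ t)) * F).prod * L).trace = 0 := by
  let T (μ : Fin l) : MultilinearMap ℝ (fun _ : Fin s => Matrix (Fin k) (Fin q) ℝ) ℝ :=
    ((Matrix.traceLinearMap (Fin p) ℝ ℝ ∘ₗ mulRightLinearMap (Fin p) ℝ L ∘ₗ
      mulLeftLinearMap (Fin k) ℝ (A μ * F)).compMultilinearMap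
        (MultilinearMap.mkPiAlgebraFin ℝ s (Matrix (Fin k) (Fin k) ℝ))).compLinearMap
          fun _ => mulRightLinearMap (Fin k) ℝ F
  have hT : ∀ μ m, T μ m = (A μ * F * (List.ofFn fun t => m t * F).prod * L).trace := by
    intro μ m
    simp [T, Matrix.mul_assoc]
  have h : ∀ w : κ → ℝ, F * ((∑ b, w b • η b) * F) ^ s ∈ traceKer A L ↔
      ∀ μ, T μ (fun _ => ∑ b, w b • η b) = 0 := by
    intro w
    rw [mem_traceKer]
    refine forall_congr' fun μ => ?_
    rw [hT, List.ofFn_const, List.prod_replicate, Matrix.mul_assoc (A μ) F]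
  rw [forall_congr' h, forall_comm, forall_comm (α := Fin s → κ)]
  refine forall_congr' fun μ => ?_
  rw [multilinear_diagonal_eq_zero_iff (T μ) η]
  simp only [hT]

/-- The trace conditions in polarized form; the case `s = 0` is the condition without any `η`. -/
theorem traceAt_iff {p q k l : ℕ} (a : (Fin q → ℝ) → Fin l → Fin p → Fin q → ℝ)
    (lam : (Fin q → ℝ) → Fin k → Fin p → ℝ) (ι : Fin k ↪ Fin p) (N : ℕ)
    (u : Fin q → ℝ) (F : Matrix (Fin q) (Fin k) ℝ) :
    TraceAt a lam ι N u F ↔ ∀ s ≤ N, ∀ w, F * (etaComb lam ι u w * F) ^ s ∈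
      traceKer (fun μ => Matrix.of (a u μ)) (Matrix.of (lam u)) := by
  unfold TraceAt etaComb
  constructor
  · rintro ⟨h0, h⟩ s hs
    rcases Nat.eq_zero_or_pos s with rfl | hs0
    · intro w
      rw [pow_zero, Matrix.mul_one]
      exact h0
    · exact (forall_mul_pow_mem_traceKer_iff
        (fun μ => Matrix.of (a u μ)) _ F (fun b : {i : Fin p // i ∉ Set.range ι} =>
          jac (fun v A => lam v A b) u) s).2 (h s hs0 hs)
  · intro h
    refine ⟨fun μ => ?_, fun s _ hs => (forall_mul_pow_mem_traceKer_iff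
        (fun μ => Matrix.of (a u μ)) _ F (fun b : {i : Fin p // i ∉ Set.range ι} =>
          jac (fun v A => lam v A b) u) s).1 (h s hs)⟩
    have h0 := h 0 (Nat.zero_le _) 0 μ
    rwa [pow_zero, Matrix.mul_one] at h0

/-- Both bounds on the order of the trace conditions come from Cayley–Hamilton, applied to the
`k × k` matrix `η F` or to the `q × q` matrix `F η`. -/
theorem mul_pow_mem_of_mul_pow_mem_le {q k N : ℕ} (hN : N = k - 1 ∨ N = q - 1)
    (V : Submodule ℝ (Matrix (Fin q) (Fin k) ℝ)) (F : Matrix (Fin q) (Fin k) ℝ)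
    (η : Matrix (Fin k) (Fin q) ℝ) (h : ∀ s ≤ N, F * (η * F) ^ s ∈ V) (s : ℕ) :
    F * (η * F) ^ s ∈ V := by
  have hcomm : ∀ s, (F * η) ^ s * F = F * (η * F) ^ s := by
    intro s
    induction s with
    | zero => simp
    | succ s ih => rw [pow_succ', pow_succ', Matrix.mul_assoc, ih]; simp only [Matrix.mul_assoc]
  rcases hN with rfl | rfl
  · have := map_aeval_mem_of_map_pow_mem (mulLeftLinearMap (Fin k) ℝ F) V (η * F)
      (fun s hs => h s (by omega)) (Polynomial.X ^ s)
    simpa using this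
  · have := map_aeval_mem_of_map_pow_mem (mulRightLinearMap (Fin q) ℝ F) V (F * η)
      (fun s hs => by simpa [hcomm] using h s (by omega)) (Polynomial.X ^ s)
    simpa [hcomm] using this

theorem mul_one_sub_inv_mem {q k : ℕ}
    (V : Submodule ℝ (Matrix (Fin q) (Fin k) ℝ)) (F : Matrix (Fin q) (Fin k) ℝ)
    (M : Matrix (Fin k) (Fin k) ℝ) (hM : (1 - M).det ≠ 0) (h : ∀ s, F * M ^ s ∈ V) :
    F * (1 - M)⁻¹ ∈ V := by
  obtain ⟨P, hP⟩ := exists_aeval_eq_one_sub_inv M hM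
  rw [hP]
  exact map_aeval_mem_of_map_pow_mem (mulLeftLinearMap (Fin k) ℝ F) V M
    (fun s _ => h s) P

theorem eq_trace_smul_one_of_le_one {n : ℕ} (hn : n ≤ 1) (M : Matrix (Fin n) (Fin n) ℝ) :
    M = M.trace • 1 := by
  have := Fin.subsingleton_iff_le_one.mpr hn
  ext i j
  rw [Subsingleton.elim j i]
  simp [Matrix.trace, Fintype.sum_subsingleton _ i]

/-- If `V` is closed under `G ↦ G η_b G`, and `G = (1 - F N)⁻¹ F` lies in `V` for a combination `N`
of the `η_b`, then so does `F = G (1 + N G)⁻¹`, a polynomial expression in `G` and `N G`, and hence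
so do all `F (η F)ˢ`. -/
theorem mul_pow_mem_of_forall_quadratic {q k : ℕ} {κ : Type*} [Fintype κ]
    (V : Submodule ℝ (Matrix (Fin q) (Fin k) ℝ))
    (η : κ → Matrix (Fin k) (Fin q) ℝ) (h : ∀ G ∈ V, ∀ b, G * η b * G ∈ V) (w₀ : κ → ℝ)
    {F : Matrix (Fin q) (Fin k) ℝ} (hdet : (1 - F * ∑ b, w₀ b • η b).det ≠ 0)
    (hF : (1 - F * ∑ b, w₀ b • η b)⁻¹ * F ∈ V) (s : ℕ) (w : κ → ℝ) :
    F * ((∑ b, w b • η b) * F) ^ s ∈ V := by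
  have hquad : ∀ (w : κ → ℝ), ∀ G ∈ V, G * (∑ b, w b • η b) * G ∈ V := by
    intro w G hG
    rw [Matrix.mul_sum, Matrix.sum_mul]
    refine V.sum_mem fun b _ => ?_
    rw [Matrix.mul_smul, Matrix.smul_mul]
    exact V.smul_mem _ (h G hG b)
  refine mul_pow_mem_of_quadratic V _ (hquad w) ?_ s
  set N := ∑ b, w₀ b • η b
  set G := (1 - F * N)⁻¹ * F with hG
  have hdet' : (1 - N * F).det ≠ 0 := by rwa [← Matrix.det_one_sub_mul_comm]
  -- `1 + N G` is the inverse of `1 - N F`, hence `F = G (1 + N G)⁻¹`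
  have hGF : G = F * (1 - N * F)⁻¹ := one_sub_mul_inv_mul F N hdet
  have h1 : (1 - N * F) * (1 - N * F)⁻¹ = 1 :=
    Matrix.mul_nonsing_inv _ (isUnit_iff_ne_zero.mpr hdet')
  have h1' : (1 - N * F)⁻¹ * (1 - N * F) = 1 :=
    Matrix.nonsing_inv_mul _ (isUnit_iff_ne_zero.mpr hdet')
  have h2 : 1 - (-N) * G = (1 - N * F)⁻¹ := by
    rw [Matrix.sub_mul, Matrix.one_mul, sub_eq_iff_eq_add'] at h1
    rw [hGF, Matrix.neg_mul, sub_neg_eq_add, ← Matrix.mul_assoc, add_comm]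
    exact h1.symm
  have h3 : (1 - (-N) * G)⁻¹ = 1 - N * F := by
    rw [h2]; exact Matrix.inv_eq_right_inv h1'
  have h4 : F = G * (1 - (-N) * G)⁻¹ := by
    rw [h3, hGF, Matrix.mul_assoc, h1', Matrix.mul_one]
  rw [h4]
  refine mul_one_sub_inv_mem V G _ ?_ fun s => mul_pow_mem_of_quadratic V _ ?_ hF s
  · rw [h2]
    exact (Matrix.isUnit_nonsing_inv_det _ (isUnit_iff_ne_zero.mpr hdet')).ne_zero
  · intro G hG
    simpa using V.neg_mem (hquad w₀ G hG)

/-- Conversely to `mul_pow_mem_of_forall_quadratic`: the condition for `s = 1` at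
`F = (1 + t G N)⁻¹ t G`, divided by `t²`, tends to `G η_b G ∈ V` as `t → 0`. -/
theorem forall_quadratic_of_mul_pow_mem {q k N : ℕ} (hN : N = k - 1 ∨ N = q - 1)
    {κ : Type*} [Fintype κ] (V : Submodule ℝ (Matrix (Fin q) (Fin k) ℝ))
    (η : κ → Matrix (Fin k) (Fin q) ℝ) (w₀ : κ → ℝ)
    (h : ∀ F : Matrix (Fin q) (Fin k) ℝ, (1 - F * ∑ b, w₀ b • η b).det ≠ 0 →
      (1 - F * ∑ b, w₀ b • η b)⁻¹ * F ∈ V → ∀ s ≤ N, ∀ w : κ → ℝ,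
        F * ((∑ b, w b • η b) * F) ^ s ∈ V)
    {G : Matrix (Fin q) (Fin k) ℝ} (hG : G ∈ V) (b : κ) : G * η b * G ∈ V := by
  classical
  -- if `N = 0` then `k ≤ 1` or `q ≤ 1`, and `G η_b G` is a multiple of `G`
  rcases Nat.eq_zero_or_pos N with h0 | hpos
  · by_cases hk : k ≤ 1
    · rw [Matrix.mul_assoc, eq_trace_smul_one_of_le_one hk (η b * G), Matrix.mul_smul,
        Matrix.mul_one]
      exact V.smul_mem _ hG
    · rw [eq_trace_smul_one_of_le_one (show q ≤ 1 by omega) (G * η b), Matrix.smul_mul,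
        Matrix.one_mul]
      exact V.smul_mem _ hG
  set M := ∑ b, w₀ b • η b
  have hE : ∀ᶠ t : ℝ in 𝓝[≠] 0, ((1 - t • (-(G * M)))⁻¹ * G) * η b *
      ((1 - t • (-(G * M)))⁻¹ * G) ∈ V := by
    filter_upwards [self_mem_nhdsWithin, (eventually_det_one_sub_smul_ne_zero
      (-(G * M))).filter_mono nhdsWithin_le_nhds] with t ht hdet
    set E := 1 - t • (-(G * M)) with hEdef
    have hEu : IsUnit E.det := isUnit_iff_ne_zero.mpr hdet
    have h1 : 1 - (t • (E⁻¹ * G)) * M = E⁻¹ := by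
      have : E⁻¹ * E - E⁻¹ * (t • (G * M)) = E⁻¹ := by
        rw [← Matrix.mul_sub, hEdef]; simp
      rw [Matrix.nonsing_inv_mul _ hEu] at this
      rw [Matrix.smul_mul, Matrix.mul_assoc, ← Matrix.mul_smul, this]
    have h2 := h (t • (E⁻¹ * G)) (by
        rw [h1]; exact (Matrix.isUnit_nonsing_inv_det _ hEu).ne_zero) (by
        rw [h1, Matrix.nonsing_inv_nonsing_inv _ hEu, Matrix.mul_smul, ← Matrix.mul_assoc,
          Matrix.mul_nonsing_inv _ hEu, Matrix.one_mul]
        exact V.smul_mem _ hG) 1 hpos (Pi.single b 1)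
    have h3 : ∑ b', (Pi.single b (1 : ℝ) : κ → ℝ) b' • η b' = η b := by
      simp [Pi.single_apply]
    rw [h3, pow_one, Matrix.mul_smul, Matrix.mul_smul, Matrix.smul_mul] at h2
    have h4 := V.smul_mem t⁻¹ (V.smul_mem t⁻¹ h2)
    rwa [inv_smul_smul₀ ht, inv_smul_smul₀ ht, ← Matrix.mul_assoc] at h4
  have hl : Tendsto (fun t : ℝ => ((1 - t • (-(G * M)))⁻¹ * G) * η b *
      ((1 - t • (-(G * M)))⁻¹ * G)) (𝓝[≠] 0) (𝓝 (G * η b * G)) := by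
    have h1 : Continuous fun X : Matrix (Fin q) (Fin q) ℝ => (X * G) * η b * (X * G) := by
      fun_prop
    have h2 := (h1.tendsto 1).comp
      ((tendsto_one_sub_smul_inv (-(G * M))).mono_left (nhdsWithin_le_nhds (s := {0}ᶜ)))
    rw [Matrix.one_mul] at h2
    exact h2
  exact (Submodule.closed_of_finiteDimensional V).mem_of_tendsto hl hE

/-! ### Jacobi matrices of implicitly given functions -/

theorem jac_mulVec {m n : ℕ} (g : (Fin m → ℝ) → (Fin n → ℝ)) (y v : Fin m → ℝ) :
    (jac g y).mulVec v = fderiv ℝ g y v := by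
  conv_rhs => rw [pi_eq_sum_univ' v, map_sum]
  ext α
  simp [Matrix.mulVec, dotProduct, jac, mul_comm]

theorem jac_apply {m n : ℕ} {g : (Fin m → ℝ) → (Fin n → ℝ)} {y : Fin m → ℝ}
    (hg : DifferentiableAt ℝ g y) (α : Fin n) (i : Fin m) :
    jac g y α i = fderiv ℝ (fun z => g z α) y (Pi.single i 1) := by
  rw [fderiv_apply hg]; rfl

theorem jac_comp {m n o : ℕ} {g : (Fin n → ℝ) → (Fin o → ℝ)} {h : (Fin m → ℝ) → (Fin n → ℝ)}
    {y : Fin m → ℝ} (hg : DifferentiableAt ℝ g (h y)) (hh : DifferentiableAt ℝ h y) :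
    jac (fun z => g (h z)) y = jac g (h y) * jac h y := by
  refine Matrix.ext_of_mulVec_single fun i => ?_
  rw [← Matrix.mulVec_mulVec, jac_mulVec, jac_mulVec, jac_mulVec]
  have := fderiv_comp y hg hh
  rw [show (fun z => g (h z)) = g ∘ h from rfl, this]
  rfl

theorem continuousAt_jac {m n : ℕ} {g : (Fin m → ℝ) → (Fin n → ℝ)} {y : Fin m → ℝ}
    (hg : ContDiffAt ℝ 1 g y) : ContinuousAt (jac g) y := by
  have h1 : ContinuousAt (fderiv ℝ g) y :=
    (hg.fderiv_right (m := 0) (by simp)).continuousAt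
  refine continuousAt_pi.2 fun α => continuousAt_pi.2 fun i => ?_
  have h2 : ContinuousAt (fun z => fderiv ℝ g z (Pi.single i 1)) y :=
    h1.clm_apply continuousAt_const
  exact (continuousAt_apply α _).comp h2

theorem contDiffAt_coeff {q k p : ℕ} {n : WithTop ℕ∞} {lam : (Fin q → ℝ) → Fin k → Fin p → ℝ}
    {u : Fin q → ℝ} (h : ContDiffAt ℝ n lam u) (A : Fin k) (i : Fin p) :
    ContDiffAt ℝ n (fun v => lam v A i) u :=
  contDiffAt_pi.1 (contDiffAt_pi.1 h A) i

theorem differentiableAt_coeff {q k p : ℕ} {lam : (Fin q → ℝ) → Fin k → Fin p → ℝ}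
    {u : Fin q → ℝ} (h : DifferentiableAt ℝ lam u) (A : Fin k) (i : Fin p) :
    DifferentiableAt ℝ (fun v => lam v A i) u :=
  differentiableAt_pi.1 (differentiableAt_pi.1 h A) i

theorem differentiableAt_column {q k p : ℕ} {lam : (Fin q → ℝ) → Fin k → Fin p → ℝ}
    {u : Fin q → ℝ} (h : DifferentiableAt ℝ lam u) (i : Fin p) :
    DifferentiableAt ℝ (fun v A => lam v A i) u :=
  differentiableAt_pi.2 fun A => differentiableAt_coeff h A i

theorem jac_riem {p q k : ℕ} {lam : (Fin q → ℝ) → Fin k → Fin p → ℝ} {u : Fin q → ℝ}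
    (h : DifferentiableAt ℝ lam u) (x : Fin p → ℝ) :
    jac (fun v => riem lam x v) u = ∑ i, x i • jac (fun v A => lam v A i) u := by
  have hr : DifferentiableAt ℝ (fun v => riem lam x v) u := by
    refine differentiableAt_pi.2 fun A => ?_
    exact DifferentiableAt.fun_sum fun i _ => (differentiableAt_coeff h A i).mul_const _
  ext A β
  rw [jac_apply hr, Matrix.sum_apply]
  simp only [riem]
  rw [fderiv_fun_sum fun i _ => (differentiableAt_coeff h A i).mul_const _]
  simp only [_root_.sum_apply]
  refine Finset.sum_congr rfl fun i _ => ?_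
  rw [fderiv_mul_const (differentiableAt_coeff h A i), Matrix.smul_apply,
    jac_apply (differentiableAt_column h i)]
  rfl

theorem contDiffAt_riem_comp {p q k : ℕ} {n : WithTop ℕ∞}
    {lam : (Fin q → ℝ) → Fin k → Fin p → ℝ}
    {u : (Fin p → ℝ) → (Fin q → ℝ)} {x : Fin p → ℝ} (hl : ContDiffAt ℝ n lam (u x))
    (hu : ContDiffAt ℝ n u x) : ContDiffAt ℝ n (fun x => riem lam x (u x)) x := by
  refine contDiffAt_pi.2 fun A => ?_
  refine ContDiffAt.sum fun i _ => ContDiffAt.mul ?_ ?_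
  · exact (contDiffAt_coeff hl A i).comp x hu
  · exact (contDiff_apply ℝ ℝ i).contDiffAt

theorem differentiableAt_riem_comp {p q k : ℕ} {lam : (Fin q → ℝ) → Fin k → Fin p → ℝ}
    {u : (Fin p → ℝ) → (Fin q → ℝ)} {x : Fin p → ℝ} (hl : DifferentiableAt ℝ lam (u x))
    (hu : DifferentiableAt ℝ u x) : DifferentiableAt ℝ (fun x => riem lam x (u x)) x := by
  refine differentiableAt_pi.2 fun A => ?_
  refine DifferentiableAt.fun_sum fun i _ => DifferentiableAt.mul ?_ ?_
  · exact (differentiableAt_coeff hl A i).comp x hu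
  · exact differentiableAt_apply i x

/-- The chain rule `dr = λ + (∂r/∂u) du` for `r(x) = λ(u(x)) x`. -/
theorem jac_riem_comp {p q k : ℕ} {lam : (Fin q → ℝ) → Fin k → Fin p → ℝ}
    {u : (Fin p → ℝ) → (Fin q → ℝ)} {x : Fin p → ℝ} (hl : DifferentiableAt ℝ lam (u x))
    (hu : DifferentiableAt ℝ u x) :
    jac (fun x => riem lam x (u x)) x =
      Matrix.of (lam (u x)) + jac (fun v => riem lam x v) (u x) * jac u x := by
  ext A m
  have h1 : ∀ i, DifferentiableAt ℝ (fun x => lam (u x) A i) x := fun i =>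
    (differentiableAt_coeff hl A i).comp x hu
  have h2 : ∀ i, DifferentiableAt ℝ (fun x : Fin p → ℝ => x i) x := fun i =>
    differentiableAt_apply i x
  rw [jac_apply (differentiableAt_riem_comp hl hu), jac_riem hl, Matrix.sum_mul]
  simp only [riem]
  rw [fderiv_fun_sum fun i _ => (h1 i).fun_mul (h2 i)]
  simp only [_root_.sum_apply, Matrix.add_apply, Matrix.sum_apply, Matrix.smul_mul,
    Matrix.smul_apply]
  have h3 : ∀ i, fderiv ℝ (fun x => lam (u x) A i * x i) x (Pi.single m 1) =
      lam (u x) A i * (Pi.single m 1 : Fin p → ℝ) i +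
        x i * (jac (fun v A => lam v A i) (u x) * jac u x) A m := by
    intro i
    rw [fderiv_fun_mul (h1 i) (h2 i)]
    rw [← jac_comp (g := fun v A => lam v A i) (differentiableAt_column hl i) hu,
      jac_apply (g := fun z A => lam (u z) A i) (differentiableAt_pi.2 fun A =>
        (differentiableAt_coeff hl A i).comp x hu)]
    have h4 : fderiv ℝ (fun x : Fin p → ℝ => x i) x = ContinuousLinearMap.proj i :=
      (ContinuousLinearMap.proj (R := ℝ) (φ := fun _ : Fin p => ℝ) i).fderiv
    rw [h4]
    rfl
  rw [Finset.sum_congr rfl fun i _ => h3 i, Finset.sum_add_distrib]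
  simp [Pi.single_apply]

theorem contDiffAt_det {E : Type*} [NormedAddCommGroup E] [NormedSpace ℝ E] {m : ℕ}
    {n : WithTop ℕ∞} {M : E → Matrix (Fin m) (Fin m) ℝ} {x : E}
    (h : ∀ i j, ContDiffAt ℝ n (fun y => M y i j) x) :
    ContDiffAt ℝ n (fun y => (M y).det) x := by
  simp only [Matrix.det_apply']
  exact ContDiffAt.sum fun σ _ => contDiffAt_const.mul (contDiffAt_prod fun i _ => h _ _)

theorem contDiffAt_adjugate {E : Type*} [NormedAddCommGroup E] [NormedSpace ℝ E] {m : ℕ}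
    {n : WithTop ℕ∞} {M : E → Matrix (Fin m) (Fin m) ℝ} {x : E}
    (h : ∀ i j, ContDiffAt ℝ n (fun y => M y i j) x) (i j : Fin m) :
    ContDiffAt ℝ n (fun y => (M y).adjugate i j) x := by
  simp only [Matrix.adjugate_apply]
  refine contDiffAt_det fun a b => ?_
  by_cases ha : a = j
  · subst ha
    simpa using contDiffAt_const
  · simpa [Matrix.updateRow_ne ha] using h a b

theorem contDiffAt_normalized {p q k : ℕ} {n : WithTop ℕ∞}
    {lam : (Fin q → ℝ) → Fin k → Fin p → ℝ}
    {ι : Fin k ↪ Fin p} {u : Fin q → ℝ} (h : ContDiffAt ℝ n lam u)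
    (hdet : (block lam ι u).det ≠ 0) : ContDiffAt ℝ n (normalized lam ι) u := by
  have hb : ∀ A B, ContDiffAt ℝ n (fun v => block lam ι v A B) u := fun A B =>
    contDiffAt_coeff h A (ι B)
  refine contDiffAt_pi.2 fun A => contDiffAt_pi.2 fun i => ?_
  simp only [normalized, Matrix.mul_apply, Matrix.inv_def, Ring.inverse_eq_inv']
  refine ContDiffAt.sum fun B _ => ContDiffAt.mul ?_ (contDiffAt_coeff h B i)
  exact ((contDiffAt_det hb).inv hdet).mul (contDiffAt_adjugate hb A B)

/-- An implicit solution `u = f(r(x, u))` satisfies `(I - (∂f/∂r)(∂r/∂u)) du = (∂f/∂r) λ`, and the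
matrix on the left is invertible near `x = 0`, where `∂r/∂u` vanishes. -/
theorem HasImplicitForm.eventually_jac {p q k : ℕ} {lam : (Fin q → ℝ) → Fin k → Fin p → ℝ}
    {u : (Fin p → ℝ) → (Fin q → ℝ)} {f : (Fin k → ℝ) → (Fin q → ℝ)}
    (hf : HasImplicitForm lam f u) (hu : ContDiffAt ℝ 1 u 0) (hl : ContDiffAt ℝ 1 lam (u 0)) :
    ∀ᶠ x in 𝓝 (0 : Fin p → ℝ),
      (1 - jac f (riem lam x (u x)) * jac (fun v => riem lam x v) (u x)).det ≠ 0 ∧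
      (1 - jac f (riem lam x (u x)) * jac (fun v => riem lam x v) (u x)) * jac u x =
        jac f (riem lam x (u x)) * Matrix.of (lam (u x)) := by
  have hr0 : riem lam 0 (u 0) = 0 := by ext A; simp [riem]
  have hrc : ContinuousAt (fun x => riem lam x (u x)) 0 := (contDiffAt_riem_comp hl hu).continuousAt
  have hr : Tendsto (fun x => riem lam x (u x)) (𝓝 0) (𝓝 0) := by
    simpa [ContinuousAt, hr0] using hrc
  have hl' : ∀ᶠ x in 𝓝 (0 : Fin p → ℝ), DifferentiableAt ℝ lam (u x) :=
    hu.continuousAt.eventually ((hl.eventually (by simp)).mono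
      fun v hv => hv.differentiableAt (by simp))
  have hu' : ∀ᶠ x in 𝓝 (0 : Fin p → ℝ), DifferentiableAt ℝ u x :=
    (hu.eventually (by simp)).mono fun v hv => hv.differentiableAt (by simp)
  have hf' : ∀ᶠ x in 𝓝 (0 : Fin p → ℝ), DifferentiableAt ℝ f (riem lam x (u x)) :=
    hr.eventually ((hf.1.eventually (by simp)).mono fun v hv => hv.differentiableAt (by simp))
  have hR : ContinuousAt (fun x : Fin p → ℝ =>
      ∑ i, x i • jac (fun v A => lam v A i) (u x)) 0 := by
    refine tendsto_finsetSum _ fun i _ => Tendsto.smul (continuousAt_apply i _) ?_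
    have h1 : ContinuousAt (jac fun v A => lam v A i) (u 0) :=
      continuousAt_jac (contDiffAt_pi.2 fun A => contDiffAt_coeff hl A i)
    exact ContinuousAt.comp (f := u) h1 hu.continuousAt
  have hF : ContinuousAt (fun x => jac f (riem lam x (u x))) 0 := by
    have h1 : ContinuousAt (jac f) (riem lam 0 (u 0)) := by
      rw [hr0]; exact continuousAt_jac hf.1
    exact ContinuousAt.comp (f := fun x => riem lam x (u x)) h1 hrc
  have hdet : ContinuousAt (fun x : Fin p → ℝ => (1 - jac f (riem lam x (u x)) *
      ∑ i, x i • jac (fun v A => lam v A i) (u x)).det) 0 := by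
    have h1 : Continuous fun X : Matrix (Fin q) (Fin k) ℝ × Matrix (Fin k) (Fin q) ℝ =>
        (1 - X.1 * X.2).det := Continuous.matrix_det (by fun_prop)
    exact ContinuousAt.comp (f := fun x : Fin p → ℝ => (jac f (riem lam x (u x)),
      ∑ i, x i • jac (fun v A => lam v A i) (u x))) h1.continuousAt (hF.prodMk hR)
  have hne := hdet.eventually_ne (y := 0) (by simp)
  filter_upwards [hl', hu', hf', hne, hf.2.eventually_nhds] with x hlx hux hfx hnex heq
  rw [← jac_riem hlx] at hnex
  refine ⟨hnex, ?_⟩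
  have h1 : jac u x = jac (fun x => f (riem lam x (u x))) x := by
    have : fderiv ℝ u x = fderiv ℝ (fun x => f (riem lam x (u x))) x :=
      Filter.EventuallyEq.fderiv_eq heq
    simp only [jac, this]
  rw [jac_comp (h := fun x => riem lam x (u x)) hfx (differentiableAt_riem_comp hlx hux),
    jac_riem_comp hlx hux, Matrix.mul_add,
    ← Matrix.mul_assoc] at h1
  rw [Matrix.sub_mul, Matrix.one_mul, sub_eq_iff_eq_add]
  exact h1

/-! ### Normalized wave vectors and functional dependence -/

theorem normalized_apply_block {p q k : ℕ} {lam : (Fin q → ℝ) → Fin k → Fin p → ℝ}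
    {ι : Fin k ↪ Fin p} {u : Fin q → ℝ} (h : (block lam ι u).det ≠ 0) (A B : Fin k) :
    normalized lam ι u A (ι B) = (1 : Matrix (Fin k) (Fin k) ℝ) A B := by
  rw [← Matrix.nonsing_inv_mul _ (isUnit_iff_ne_zero.mpr h)]
  rfl

theorem block_mul_normalized {p q k : ℕ} {lam : (Fin q → ℝ) → Fin k → Fin p → ℝ}
    {ι : Fin k ↪ Fin p} {u : Fin q → ℝ} (h : (block lam ι u).det ≠ 0) :
    block lam ι u * Matrix.of (normalized lam ι u) = Matrix.of (lam u) := by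
  have h1 : Matrix.of (normalized lam ι u) = (block lam ι u)⁻¹ * Matrix.of (lam u) := rfl
  rw [h1, ← Matrix.mul_assoc, Matrix.mul_nonsing_inv _ (isUnit_iff_ne_zero.mpr h), Matrix.one_mul]

theorem det_block_normalized {p q k : ℕ} {lam : (Fin q → ℝ) → Fin k → Fin p → ℝ}
    {ι : Fin k ↪ Fin p} {u : Fin q → ℝ} (h : (block lam ι u).det ≠ 0) :
    (block (normalized lam ι) ι u).det ≠ 0 := by
  have : block (normalized lam ι) ι u = 1 := by
    ext A B; exact normalized_apply_block h A B
  rw [this, Matrix.det_one]; exact one_ne_zero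

theorem card_compl_range {p k : ℕ} (ι : Fin k ↪ Fin p) :
    Fintype.card {i : Fin p // i ∉ Set.range ι} = p - k := by
  have h := Fintype.card_subtype_compl (fun i => i ∈ Set.range ι)
  rw [h, Fintype.card_fin]
  congr 1
  have h2 := Set.card_range_of_injective ι.injective
  rw [Fintype.card_fin] at h2
  exact Eq.trans (Fintype.card_congr (Equiv.refl _)) h2

theorem sum_eq_of_eq_zero_off_range {p k : ℕ} (ι : Fin k ↪ Fin p) {v : Fin p → ℝ}
    (hv : ∀ i, i ∉ Set.range ι → v i = 0) : ∑ i, v i = ∑ B, v (ι B) :=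
  (Fintype.sum_of_injective ι ι.injective _ _ hv fun _ => rfl).symm

/-- The annihilator of an orthogonal frame is the span of the rows of `λ̃`: the frame spans the
kernel of `λ`, by dimension, and the coefficients are read off in the columns `i_1, …, i_k`. -/
theorem eq_sum_normalized_of_frame {p q k : ℕ} {lam : (Fin q → ℝ) → Fin k → Fin p → ℝ}
    {ι : Fin k ↪ Fin p} {u : Fin q → ℝ} (hdet : (block lam ι u).det ≠ 0)
    (hli : LinearIndependent ℝ (lam u))
    {ξ : Fin (p - k) → Fin p → ℝ} (hξ : LinearIndependent ℝ ξ)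
    (horth : ∀ A b, ∑ i, lam u A i * ξ b i = 0) {y : Fin p → ℝ}
    (hy : ∀ b, ∑ i, ξ b i * y i = 0) (i : Fin p) :
    y i = ∑ A, y (ι A) * normalized lam ι u A i := by
  have hrank : Module.finrank ℝ (Matrix.of (lam u)).mulVecLin.ker = p - k := by
    have h1 := (Matrix.of (lam u)).mulVecLin.finrank_range_add_finrank_ker
    have h2 : (Matrix.of (lam u)).rank = k := by
      have := LinearIndependent.rank_matrix (M := Matrix.of (lam u)) hli
      simpa using this
    rw [Module.finrank_fin_fun] at h1
    unfold Matrix.rank at h2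
    omega
  have hle : Submodule.span ℝ (Set.range ξ) ≤ (Matrix.of (lam u)).mulVecLin.ker := by
    rw [Submodule.span_le]
    rintro _ ⟨b, rfl⟩
    ext A
    exact horth A b
  have heq : Submodule.span ℝ (Set.range ξ) = (Matrix.of (lam u)).mulVecLin.ker := by
    refine Submodule.eq_of_le_of_finrank_eq hle ?_
    rw [finrank_span_eq_card hξ, hrank, Fintype.card_fin]
  -- the relation to be shown is the vanishing of `y` at the vector `z`, which lies in the kernel
  set z : Fin p → ℝ := Pi.single i 1 - ∑ A, normalized lam ι u A i • Pi.single (ι A) 1 with hz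
  have hz1 : (Matrix.of (normalized lam ι u)).mulVec z = 0 := by
    rw [hz, Matrix.mulVec_sub, Matrix.mulVec_sum, sub_eq_zero]
    ext B
    simp only [Matrix.mulVec_smul, Matrix.mulVec_single_one, Finset.sum_apply, Pi.smul_apply,
      Matrix.col_apply, Matrix.of_apply, normalized_apply_block hdet, smul_eq_mul,
      Matrix.one_apply]
    simp
  have hz2 : z ∈ Submodule.span ℝ (Set.range ξ) := by
    rw [heq, LinearMap.mem_ker, Matrix.mulVecLin_apply, ← block_mul_normalized hdet,
      ← Matrix.mulVec_mulVec, hz1, Matrix.mulVec_zero]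
  have hz3 : Submodule.span ℝ (Set.range ξ) ≤
      LinearMap.ker (∑ i, y i • (LinearMap.proj i : (Fin p → ℝ) →ₗ[ℝ] ℝ)) := by
    rw [Submodule.span_le]
    rintro _ ⟨b, rfl⟩
    simpa [mul_comm] using hy b
  have hz4 := hz3 hz2
  simp only [hz, LinearMap.mem_ker, map_sub, map_sum, map_smul, LinearMap.sum_apply,
    LinearMap.smul_apply, LinearMap.proj_apply, smul_eq_mul, Pi.single_apply, mul_ite, mul_one,
    mul_zero, Finset.sum_ite_eq', Finset.mem_univ, if_true, sub_eq_zero] at hz4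
  rw [hz4]
  exact Finset.sum_congr rfl fun A _ => mul_comm _ _

/-- The covectors `λ^A` and the coordinates `x^b`, `b ≠ i_1, …, i_k`, form a basis of the dual. -/
theorem exists_adapted_coordinates {p q k : ℕ} {lam : (Fin q → ℝ) → Fin k → Fin p → ℝ}
    (ι : Fin k ↪ Fin p) {u : Fin q → ℝ} (hdet : (block lam ι u).det ≠ 0) (hkp : k ≤ p) :
    ∃ e : (Fin p → ℝ) ≃L[ℝ] (Fin k → ℝ) × ({i : Fin p // i ∉ Set.range ι} → ℝ),
      ∀ v, e v = ((Matrix.of (lam u)).mulVec v, fun b => v b.1) := by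
  let g : (Fin p → ℝ) →ₗ[ℝ] (Fin k → ℝ) × ({i : Fin p // i ∉ Set.range ι} → ℝ) :=
    (Matrix.of (lam u)).mulVecLin.prod (LinearMap.funLeft ℝ ℝ Subtype.val)
  have hg : Function.Injective g := by
    rw [← LinearMap.ker_eq_bot, LinearMap.ker_eq_bot']
    intro v hv
    have h1 : (Matrix.of (lam u)).mulVec v = 0 := congrArg Prod.fst hv
    have h2 : ∀ i, i ∉ Set.range ι → v i = 0 := fun i hi =>
      congrFun (congrArg Prod.snd hv) ⟨i, hi⟩
    have h3 : (block lam ι u).mulVec (fun B => v (ι B)) = 0 := by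
      rw [← h1]
      ext A
      exact (sum_eq_of_eq_zero_off_range ι (v := fun i => lam u A i * v i)
        fun i hi => by simp [h2 i hi]).symm
    have h4 := Matrix.eq_zero_of_mulVec_eq_zero hdet h3
    ext i
    by_cases hi : i ∈ Set.range ι
    · obtain ⟨B, rfl⟩ := hi
      exact congrFun h4 B
    · exact h2 i hi
  refine ⟨(LinearEquiv.ofInjectiveOfFinrankEq g hg ?_).toContinuousLinearEquiv, fun v => rfl⟩
  rw [Module.finrank_prod, Module.finrank_fin_fun, Module.finrank_fin_fun,
    Module.finrank_fintype_fun_eq_card, card_compl_range]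
  omega

/-- Functional dependence: if `r` is completed to local coordinates by a linear map `w`, and `du`
vanishes on the kernel of `dr` near `0`, then `u` is locally a `C¹` function of `r`. -/
theorem exists_eventually_eq_comp {E F G H : Type*} [NormedAddCommGroup E] [NormedSpace ℝ E]
    [CompleteSpace E] [NormedAddCommGroup F] [NormedSpace ℝ F] [NormedAddCommGroup G]
    [NormedSpace ℝ G] [NormedAddCommGroup H] [NormedSpace ℝ H] {r : E → F} {u : E → H}
    (w : E →L[ℝ] G) (e : E ≃L[ℝ] F × G) (hr : ContDiffAt ℝ 1 r 0) (hr0 : r 0 = 0)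
    (hu : ContDiffAt ℝ 1 u 0) (he : ∀ v, e v = (fderiv ℝ r 0 v, w v))
    (hker : ∀ᶠ x in 𝓝 0, ∀ v, fderiv ℝ r x v = 0 → fderiv ℝ u x v = 0) :
    ∃ f : F → H, ContDiffAt ℝ 1 f 0 ∧ ∀ᶠ x in 𝓝 0, u x = f (r x) := by
  let Φ : E → F × G := fun x => (r x, w x)
  have hΦ : ContDiffAt ℝ 1 Φ 0 := hr.prodMk w.contDiff.contDiffAt
  have hΦ0 : Φ 0 = 0 := by simp [Φ, hr0]
  have hΦ' : HasFDerivAt Φ (e : E →L[ℝ] F × G) 0 := by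
    have h1 := (hr.differentiableAt (by simp)).hasFDerivAt.prodMk (w.hasFDerivAt (x := 0))
    convert h1 using 1
    ext v <;> simp [he]
  have hs : HasStrictFDerivAt Φ (e : E →L[ℝ] F × G) 0 := hΦ.hasStrictFDerivAt' hΦ' (by simp)
  let ψ : F × G → E := hs.localInverse Φ e 0
  have hψ : ContDiffAt ℝ 1 ψ 0 := by
    have := hΦ.to_localInverse hΦ' (by simp)
    rwa [hΦ0] at this
  have hψ0 : ψ 0 = 0 := by
    have := hs.localInverse_apply_image
    rwa [hΦ0] at this
  have hψt : Tendsto ψ (𝓝 0) (𝓝 0) := by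
    have := hψ.continuousAt.tendsto
    rwa [hψ0] at this
  have hright : ∀ᶠ y in 𝓝 (0 : F × G), Φ (ψ y) = y := by
    have := hs.eventually_right_inverse
    rwa [hΦ0] at this
  have hleft : ∀ᶠ x in 𝓝 (0 : E), ψ (Φ x) = x := hs.eventually_left_inverse
  have hg : ContDiffAt ℝ 1 (fun y => u (ψ y)) 0 :=
    ContDiffAt.comp (g := u) (0 : F × G) (by rwa [hψ0]) hψ
  have hzero : ∀ᶠ y in 𝓝 (0 : F × G), DifferentiableAt ℝ (fun y => u (ψ y)) y ∧
      ∀ b : G, fderiv ℝ (fun y => u (ψ y)) y (0, b) = 0 := by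
    filter_upwards [hright.eventually_nhds, hψt.eventually hker,
      hψt.eventually (hu.eventually (by simp)), hψt.eventually (hr.eventually (by simp)),
      hψ.eventually (by simp)] with y hy hk hu' hr' hψ'
    have du := hu'.differentiableAt one_ne_zero
    have dr := hr'.differentiableAt one_ne_zero
    have dψ := hψ'.differentiableAt one_ne_zero
    refine ⟨du.comp y dψ, fun b => ?_⟩
    have h1 : fderiv ℝ (fun y => u (ψ y)) y = (fderiv ℝ u (ψ y)).comp (fderiv ℝ ψ y) :=
      fderiv_comp y du dψ
    rw [h1]
    refine hk _ ?_
    have h2 : fderiv ℝ (fun y => r (ψ y)) y = (fderiv ℝ r (ψ y)).comp (fderiv ℝ ψ y) :=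
      fderiv_comp y dr dψ
    have h3 : (fun y => r (ψ y)) =ᶠ[𝓝 y] Prod.fst := hy.mono fun z hz => congrArg Prod.fst hz
    rw [h3.fderiv_eq, fderiv_fst] at h2
    exact (congrArg (fun T : F × G →L[ℝ] F => T (0, b)) h2).symm
  obtain ⟨ε, hε, hball⟩ := Metric.eventually_nhds_iff_ball.1 hzero
  refine ⟨fun s => u (ψ (s, 0)), ?_, ?_⟩
  · exact ContDiffAt.comp (g := fun y => u (ψ y)) (f := fun s : F => (s, (0 : G))) (0 : F) hg
      (contDiffAt_id.prodMk contDiffAt_const)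
  · have hΦt : Tendsto Φ (𝓝 0) (𝓝 0) := by
      have := hΦ.continuousAt.tendsto
      rwa [hΦ0] at this
    filter_upwards [hleft, hΦt.eventually (Metric.ball_mem_nhds _ hε)] with x hx hxb
    replace hxb : ‖Φ x‖ < ε := mem_ball_zero_iff.1 hxb
    have hmem : ∀ b ∈ Metric.ball (0 : G) ε, (r x, b) ∈ Metric.ball (0 : F × G) ε := by
      intro b hb
      rw [mem_ball_zero_iff] at hb ⊢
      exact max_lt ((le_max_left _ _).trans_lt hxb) hb
    have hd : ∀ b ∈ Metric.ball (0 : G) ε,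
        HasFDerivAt (fun b => u (ψ (r x, b))) (0 : G →L[ℝ] H) b := by
      intro b hb
      have h1 := hball _ (hmem b hb)
      have h2 : HasFDerivAt (fun b => u (ψ (r x, b)))
          ((fderiv ℝ (fun y => u (ψ y)) (r x, b)).comp (ContinuousLinearMap.inr ℝ F G)) b :=
        h1.1.hasFDerivAt.comp (f := fun b => (r x, b)) b (hasFDerivAt_prodMk_right (r x) b)
      convert h2 using 1
      ext c
      exact (h1.2 c).symm
    have hw : w x ∈ Metric.ball (0 : G) ε := by
      rw [mem_ball_zero_iff]
      exact (le_max_right _ _).trans_lt hxb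
    have h5 := Metric.isOpen_ball.is_const_of_fderiv_eq_zero (𝕜 := ℝ)
      (convex_ball (0 : G) ε).isPreconnected
      (fun b hb => (hd b hb).differentiableAt.differentiableWithinAt)
      (fun b hb => (hd b hb).fderiv) hw (Metric.mem_ball_self hε)
    calc u x = u (ψ (r x, w x)) := by rw [show (r x, w x) = Φ x from rfl, hx]
      _ = _ := h5

/-! ### Invariant graphs, ranks and solutions -/

theorem jac_riem_comp_zero {p q k : ℕ} {lam : (Fin q → ℝ) → Fin k → Fin p → ℝ}
    {u : (Fin p → ℝ) → (Fin q → ℝ)} (hl : DifferentiableAt ℝ lam (u 0))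
    (hu : DifferentiableAt ℝ u 0) :
    jac (fun x => riem lam x (u x)) 0 = Matrix.of (lam (u 0)) := by
  rw [jac_riem_comp hl hu, jac_riem hl]
  simp

theorem riem_zero {p q k : ℕ} (lam : (Fin q → ℝ) → Fin k → Fin p → ℝ) (u : Fin q → ℝ) :
    riem lam 0 u = 0 := by
  ext A; simp [riem]

theorem eqn_eq_trace {p q l : ℕ} (a : (Fin q → ℝ) → Fin l → Fin p → Fin q → ℝ) (μ : Fin l)
    (j : Jet p q) :
    eqn a μ j = (Matrix.of (a j.2.1 μ) * Matrix.of j.2.2).trace := by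
  simp [eqn, Matrix.trace, Matrix.mul_apply]

/-- For derivatives of the form `F λ` the system is the membership of `F` in `traceKer`. -/
theorem forall_eqn_eq_zero_iff {p q k l : ℕ} {a : (Fin q → ℝ) → Fin l → Fin p → Fin q → ℝ}
    {j : Jet p q} {F : Matrix (Fin q) (Fin k) ℝ} {L : Matrix (Fin k) (Fin p) ℝ}
    (h : Matrix.of j.2.2 = F * L) :
    (∀ μ, eqn a μ j = 0) ↔ F ∈ traceKer (fun μ => Matrix.of (a j.2.1 μ)) L := by
  rw [mem_traceKer]
  refine forall_congr' fun μ => ?_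
  rw [eqn_eq_trace, h, Matrix.mul_assoc]

theorem jac_normalized_block {p q k : ℕ} {lam : (Fin q → ℝ) → Fin k → Fin p → ℝ}
    {ι : Fin k ↪ Fin p} {u : Fin q → ℝ} (hdet : ∀ᶠ v in 𝓝 u, (block lam ι v).det ≠ 0)
    (B : Fin k) : jac (fun v A => normalized lam ι v A (ι B)) u = 0 := by
  have h1 : (fun v A => normalized lam ι v A (ι B)) =ᶠ[𝓝 u]
      fun _ A => (1 : Matrix (Fin k) (Fin k) ℝ) A B :=
    hdet.mono fun v hv => funext fun A => normalized_apply_block hv A B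
  ext A i
  simp [jac, h1.fderiv_eq]

theorem sum_subtype_of_eq_zero_on_range {p k : ℕ} (ι : Fin k ↪ Fin p) {M : Type*}
    [AddCommMonoid M] {g : Fin p → M} (h : ∀ B, g (ι B) = 0) :
    ∑ i, g i = ∑ b : {i : Fin p // i ∉ Set.range ι}, g b := by
  rw [← Fintype.sum_subtype_add_sum_subtype (fun i => i ∈ Set.range ι) g, Finset.sum_eq_zero,
    zero_add]
  rintro ⟨_, B, rfl⟩ _
  exact h B

theorem jac_riem_normalized {p q k : ℕ} {lam : (Fin q → ℝ) → Fin k → Fin p → ℝ}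
    {ι : Fin k ↪ Fin p} {u : Fin q → ℝ} (hl : DifferentiableAt ℝ (normalized lam ι) u)
    (hdet : ∀ᶠ v in 𝓝 u, (block lam ι v).det ≠ 0) (x : Fin p → ℝ) :
    jac (fun v => riem (normalized lam ι) x v) u =
      etaComb (normalized lam ι) ι u (fun b => x b) := by
  rw [jac_riem hl, etaComb]
  exact sum_subtype_of_eq_zero_on_range ι fun B => by rw [jac_normalized_block hdet, smul_zero]

theorem rank_mul_eq_left_of_block {p q k : ℕ} {lam : (Fin q → ℝ) → Fin k → Fin p → ℝ}
    {ι : Fin k ↪ Fin p} {u : Fin q → ℝ} (hdet : (block lam ι u).det ≠ 0)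
    (F : Matrix (Fin q) (Fin k) ℝ) : (F * Matrix.of (lam u)).rank = F.rank := by
  refine le_antisymm (Matrix.rank_mul_le_left _ _) ?_
  -- the columns `i_1, …, i_k` of `F λ` form the matrix `F Λ`, and `Λ` is invertible
  have h1 : F * block lam ι u = F * Matrix.of (lam u) *
      (1 : Matrix (Fin p) (Fin p) ℝ).submatrix id ι := by
    rw [Matrix.mul_assoc]
    congr 1
    ext A B
    simp [Matrix.mul_apply, Matrix.one_apply, block]
  rw [← Matrix.rank_mul_eq_left_of_isUnit_det (block lam ι u) F (isUnit_iff_ne_zero.mpr hdet), h1]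
  exact Matrix.rank_mul_le_left _ _

theorem HasImplicitForm.eventually_rank_eq {p q k : ℕ}
    {lam : (Fin q → ℝ) → Fin k → Fin p → ℝ} {ι : Fin k ↪ Fin p}
    {u : (Fin p → ℝ) → (Fin q → ℝ)} {f : (Fin k → ℝ) → (Fin q → ℝ)}
    (hf : HasImplicitForm lam f u) (hu : ContDiffAt ℝ 1 u 0) (hl : ContDiffAt ℝ 1 lam (u 0))
    (hdet : ∀ᶠ v in 𝓝 (u 0), (block lam ι v).det ≠ 0) :
    ∀ᶠ x in 𝓝 (0 : Fin p → ℝ), (jac u x).rank = (jac f (riem lam x (u x))).rank := by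
  filter_upwards [hf.eventually_jac hu hl, hu.continuousAt.eventually hdet] with x hx hd
  rw [← rank_mul_eq_left_of_block hd, ← hx.2,
    Matrix.rank_mul_eq_right_of_isUnit_det _ _ (isUnit_iff_ne_zero.mpr hx.1)]

theorem graphInvariant_iff {p q n : ℕ} {ξ : (Fin q → ℝ) → Fin n → Fin p → ℝ}
    {u : (Fin p → ℝ) → (Fin q → ℝ)} :
    GraphInvariant ξ u ↔ ∀ᶠ x in 𝓝 (0 : Fin p → ℝ), ∀ b, (jac u x).mulVec (ξ (u x) b) = 0 := by
  refine eventually_congr (Eventually.of_forall fun x => forall_congr' fun b => ?_)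
  rw [jac_mulVec]
  simp only [vf, Prod.mk.injEq]
  constructor
  · rintro ⟨v, rfl, h⟩
    exact h.symm
  · exact fun h => ⟨_, rfl, h.symm⟩

theorem HasImplicitForm.graphInvariant {p q k n : ℕ}
    {lam : (Fin q → ℝ) → Fin k → Fin p → ℝ}
    {ξ : (Fin q → ℝ) → Fin n → Fin p → ℝ}
    {u : (Fin p → ℝ) → (Fin q → ℝ)} {f : (Fin k → ℝ) → (Fin q → ℝ)}
    (hf : HasImplicitForm lam f u) (hu : ContDiffAt ℝ 1 u 0) (hl : ContDiffAt ℝ 1 lam (u 0))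
    (horth : ∀ᶠ v in 𝓝 (u 0), ∀ A b, ∑ i, lam v A i * ξ v b i = 0) :
    GraphInvariant ξ u := by
  rw [graphInvariant_iff]
  filter_upwards [hf.eventually_jac hu hl, hu.continuousAt.eventually horth] with x hx ho b
  refine Matrix.eq_zero_of_mulVec_eq_zero hx.1 ?_
  have h1 : (Matrix.of (lam (u x))).mulVec (ξ (u x) b) = 0 := funext fun A => ho A b
  rw [Matrix.mulVec_mulVec, hx.2, ← Matrix.mulVec_mulVec, h1, Matrix.mulVec_zero]

/-- A matrix `J` with `J ξ_b = 0` for all `b` is `F λ̃`, where `F` consists of the columns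
`i_1, …, i_k` of `J`. -/
theorem eq_submatrix_mul_normalized {p q k : ℕ} {U : Set (Fin q → ℝ)}
    {lam : (Fin q → ℝ) → Fin k → Fin p → ℝ}
    {ι : Fin k ↪ Fin p} {u : Fin q → ℝ} (hu : u ∈ U) (hdet : (block lam ι u).det ≠ 0)
    (hli : LinearIndependent ℝ (lam u)) {ξ : (Fin q → ℝ) → Fin (p - k) → Fin p → ℝ}
    (hξ : IsOrthogonalFrame lam U ξ) {m : ℕ} {J : Matrix (Fin m) (Fin p) ℝ}
    (hJ : ∀ b, J.mulVec (ξ u b) = 0) :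
    J = J.submatrix id ι * Matrix.of (normalized lam ι u) := by
  ext α i
  refine eq_sum_normalized_of_frame hdet hli (hξ.linearIndependent u hu) (hξ.orthogonal u hu)
    (y := J α) (fun b => ?_) i
  simpa [Matrix.mulVec, dotProduct, mul_comm] using congrFun (hJ b) α

/-- For an invariant graph, `du` and `dr` are both multiples of `λ̃`, and `dr = (dr)_ι λ̃` with an
invertible matrix `(dr)_ι` of its columns `i_1, …, i_k`; so `ker dr ≤ ker du`. -/
theorem GraphInvariant.exists_hasImplicitForm {p q k : ℕ} {U : Set (Fin q → ℝ)}
    {lam : (Fin q → ℝ) → Fin k → Fin p → ℝ} {ι : Fin k ↪ Fin p}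
    {ξ : (Fin q → ℝ) → Fin (p - k) → Fin p → ℝ} {u : (Fin p → ℝ) → (Fin q → ℝ)}
    (hkp : k ≤ p) (hU : U ∈ 𝓝 (u 0))
    (hl : ContDiffAt ℝ 1 lam (u 0)) (hli : ∀ v ∈ U, LinearIndependent ℝ (lam v))
    (hdet : ∀ v ∈ U, (block lam ι v).det ≠ 0) (hξ : IsOrthogonalFrame lam U ξ)
    (hu : ContDiffAt ℝ 1 u 0) (h : GraphInvariant ξ u) :
    ∃ f : (Fin k → ℝ) → (Fin q → ℝ), HasImplicitForm lam f u := by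
  have hu0 : u 0 ∈ U := mem_of_mem_nhds hU
  have hr : ContDiffAt ℝ 1 (fun x => riem lam x (u x)) 0 := contDiffAt_riem_comp hl hu
  have hjac0 := jac_riem_comp_zero (hl.differentiableAt one_ne_zero)
    (hu.differentiableAt one_ne_zero)
  obtain ⟨e, he⟩ := exists_adapted_coordinates ι (hdet _ hu0) hkp
  let w : (Fin p → ℝ) →L[ℝ] ({i : Fin p // i ∉ Set.range ι} → ℝ) :=
    ContinuousLinearMap.pi fun b => ContinuousLinearMap.proj b.1
  obtain ⟨f, hf, hfu⟩ := exists_eventually_eq_comp (r := fun x => riem lam x (u x)) w e hr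
    (riem_zero lam _) hu (fun v => by rw [he, ← jac_mulVec, hjac0]; rfl) (by
      have hne : ∀ᶠ x in 𝓝 (0 : Fin p → ℝ),
          ((jac (fun x => riem lam x (u x)) x).submatrix id ι).det ≠ 0 := by
        have h1 : Continuous fun X : Matrix (Fin k) (Fin p) ℝ => (X.submatrix id ι).det :=
          Continuous.matrix_det (by fun_prop)
        refine (ContinuousAt.comp h1.continuousAt (continuousAt_jac hr)).eventually_ne ?_
        rw [Function.comp_apply, hjac0]
        exact hdet _ hu0
      have hl' : ∀ᶠ x in 𝓝 (0 : Fin p → ℝ), DifferentiableAt ℝ lam (u x) :=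
        hu.continuousAt.eventually ((hl.eventually (by simp)).mono
          fun v hv => hv.differentiableAt (by simp))
      filter_upwards [hne, hl', hu.eventually (by simp), hu.continuousAt.eventually hU,
        graphInvariant_iff.1 h] with x hnx hlx hux hUx hJ v hv
      replace hux := hux.differentiableAt one_ne_zero
      have h1 := eq_submatrix_mul_normalized hUx (hdet _ hUx) (hli _ hUx) hξ hJ
      -- `du = (du)_ι λ̃` gives `dr = (dr)_ι λ̃`
      have h2 : jac (fun x => riem lam x (u x)) x =
          (jac (fun x => riem lam x (u x)) x).submatrix id ι *
            Matrix.of (normalized lam ι (u x)) := by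
        have h3 := jac_riem_comp hlx hux
        have h4 : (jac (fun x => riem lam x (u x)) x).submatrix id ι = block lam ι (u x) +
            jac (fun v => riem lam x v) (u x) * (jac u x).submatrix id ι := by
          rw [h3]; rfl
        rw [h4, Matrix.add_mul, block_mul_normalized (hdet _ hUx), Matrix.mul_assoc, ← h1, h3]
      rw [← jac_mulVec, h2, ← Matrix.mulVec_mulVec] at hv
      rw [← jac_mulVec, h1, ← Matrix.mulVec_mulVec, Matrix.eq_zero_of_mulVec_eq_zero hnx hv,
        Matrix.mulVec_zero])
  exact ⟨f, hf, hfu⟩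

theorem etaComb_smul {p q k : ℕ} (lam : (Fin q → ℝ) → Fin k → Fin p → ℝ) (ι : Fin k ↪ Fin p)
    (u : Fin q → ℝ) (t : ℝ) (w : {i : Fin p // i ∉ Set.range ι} → ℝ) :
    etaComb lam ι u (t • w) = t • etaComb lam ι u w := by
  simp [etaComb, Finset.smul_sum, smul_smul]

/-- Near `x = 0` the system for `u = f(r̃)` is a condition on `f` at `r = r̃(x, u(x))` alone, with
the coordinates `x^b`, `b ≠ i_1, …, i_k`, as parameters. -/
theorem HasImplicitForm.eventually_eqn_iff {p q k l : ℕ}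
    (a : (Fin q → ℝ) → Fin l → Fin p → Fin q → ℝ)
    {lam : (Fin q → ℝ) → Fin k → Fin p → ℝ} {ι : Fin k ↪ Fin p}
    {u : (Fin p → ℝ) → (Fin q → ℝ)} {f : (Fin k → ℝ) → (Fin q → ℝ)}
    (hf : HasImplicitForm (normalized lam ι) f u) (hu : ContDiffAt ℝ 1 u 0)
    (hl : ContDiffAt ℝ 1 (normalized lam ι) (u 0))
    (hdet : ∀ᶠ v in 𝓝 (u 0), (block lam ι v).det ≠ 0) :
    ∀ᶠ x in 𝓝 (0 : Fin p → ℝ), ∃ (r : Fin k → ℝ) (M : Matrix (Fin k) (Fin k) ℝ),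
      r = riem (normalized lam ι) x (u x) ∧
      M = etaComb (normalized lam ι) ι (f r) (fun b => x b) * jac f r ∧ u x = f r ∧
      (1 - M).det ≠ 0 ∧ ((∀ μ, eqn a μ (jet u x) = 0) ↔ jac f r * (1 - M)⁻¹ ∈
        traceKer (fun μ => Matrix.of (a (f r) μ)) (Matrix.of (normalized lam ι (f r)))) := by
  have hl' : ∀ᶠ x in 𝓝 (0 : Fin p → ℝ), DifferentiableAt ℝ (normalized lam ι) (u x) :=
    hu.continuousAt.eventually ((hl.eventually (by simp)).mono
      fun v hv => hv.differentiableAt (by simp))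
  filter_upwards [hf.eventually_jac hu hl, hl', hu.continuousAt.eventually hdet.eventually_nhds,
    hf.2] with x hx hlx hdx hux
  rw [jac_riem_normalized hlx hdx] at hx
  refine ⟨_, _, rfl, rfl, hux, ?_⟩
  rw [← hux, ← Matrix.det_one_sub_mul_comm]
  refine ⟨hx.1, ?_⟩
  rw [← one_sub_mul_inv_mul _ _ hx.1]
  refine forall_eqn_eq_zero_iff (j := jet u x) ?_
  rw [Matrix.mul_assoc, ← hx.2, ← Matrix.mul_assoc,
    Matrix.nonsing_inv_mul _ (isUnit_iff_ne_zero.mpr hx.1), Matrix.one_mul]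
  rfl

/-- Since `r` and the `x^b` are independent coordinates, a solution satisfies the equation
`tr (A^μ F (1 - η F)⁻¹ λ̃) = 0` at each `r` for all small combinations `η`; expanding in powers of
`η` gives the trace conditions, and Cayley–Hamilton shows that those of order `≤ N` suffice. -/
theorem HasImplicitForm.isSolution_iff {p q k l N : ℕ} (hN : N = k - 1 ∨ N = q - 1) (hkp : k ≤ p)
    (a : (Fin q → ℝ) → Fin l → Fin p → Fin q → ℝ)
    {lam : (Fin q → ℝ) → Fin k → Fin p → ℝ} {ι : Fin k ↪ Fin p}
    {u : (Fin p → ℝ) → (Fin q → ℝ)} {f : (Fin k → ℝ) → (Fin q → ℝ)}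
    (hf : HasImplicitForm (normalized lam ι) f u) (hu : ContDiffAt ℝ 1 u 0)
    (hl : ContDiffAt ℝ 1 (normalized lam ι) (u 0))
    (hdet : ∀ᶠ v in 𝓝 (u 0), (block lam ι v).det ≠ 0) :
    IsSolution a u ↔
      ∀ᶠ r in 𝓝 (0 : Fin k → ℝ), TraceAt a (normalized lam ι) ι N (f r) (jac f r) := by
  have hev := hf.eventually_eqn_iff a hu hl hdet
  have hr : ContDiffAt ℝ 1 (fun x => riem (normalized lam ι) x (u x)) 0 :=
    contDiffAt_riem_comp hl hu
  constructor
  · intro hsol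
    let w : (Fin p → ℝ) →L[ℝ] ({i : Fin p // i ∉ Set.range ι} → ℝ) :=
      ContinuousLinearMap.pi fun b => ContinuousLinearMap.proj b.1
    let Φ : (Fin p → ℝ) → (Fin k → ℝ) × ({i : Fin p // i ∉ Set.range ι} → ℝ) :=
      fun x => (riem (normalized lam ι) x (u x), w x)
    have hΦ0 : Φ 0 = 0 := by simp [Φ, riem_zero]
    obtain ⟨e, he⟩ := exists_adapted_coordinates (lam := normalized lam ι) ι
      (det_block_normalized hdet.self_of_nhds) hkp
    have hΦ : HasStrictFDerivAt Φ (e : (Fin p → ℝ) →L[ℝ] _) 0 := by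
      have h1 := (hr.hasStrictFDerivAt one_ne_zero).prodMk (w.hasStrictFDerivAt (x := 0))
      have h2 : (e : (Fin p → ℝ) →L[ℝ] _) =
          (fderiv ℝ (fun x => riem (normalized lam ι) x (u x)) 0).prod w := by
        refine ContinuousLinearMap.ext fun v => ?_
        rw [ContinuousLinearEquiv.coe_coe, he, ContinuousLinearMap.prod_apply, ← jac_mulVec,
          jac_riem_comp_zero (hl.differentiableAt one_ne_zero) (hu.differentiableAt one_ne_zero)]
        rfl
      rw [h2]
      exact h1
    -- `Φ` is open at `0`, so `(r, x^a)` take all small values independently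
    have hmap : map Φ (𝓝 0) = 𝓝 (0, 0) := by
      rw [hΦ.map_nhds_eq_of_equiv, hΦ0]; rfl
    have hQ : ∀ᶠ y : (Fin k → ℝ) × ({i : Fin p // i ∉ Set.range ι} → ℝ) in 𝓝 (0, 0),
        jac f y.1 * (1 - etaComb (normalized lam ι) ι (f y.1) y.2 * jac f y.1)⁻¹ ∈
          traceKer (fun μ => Matrix.of (a (f y.1) μ))
            (Matrix.of (normalized lam ι (f y.1))) := by
      rw [← hmap, eventually_map]
      filter_upwards [hev, hsol] with x hx hs
      obtain ⟨r, M, rfl, rfl, -, -, hx⟩ := hx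
      exact hx.1 hs
    filter_upwards [hQ.curry_nhds] with r hrw
    rw [traceAt_iff]
    intro s _ v
    refine mul_pow_mem_of_eventually_resolvent_mem _ _ _ ?_ s
    have ht : Tendsto (fun t : ℝ => t • v) (𝓝 0) (𝓝 0) := by
      have : Continuous fun t : ℝ => t • v := by fun_prop
      simpa using this.tendsto 0
    filter_upwards [ht.eventually hrw] with t ht
    rwa [etaComb_smul, Matrix.smul_mul] at ht
  · intro htr
    have hrt : Tendsto (fun x => riem (normalized lam ι) x (u x)) (𝓝 0) (𝓝 0) := by
      simpa [ContinuousAt, riem_zero] using hr.continuousAt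
    filter_upwards [hev, hrt.eventually htr] with x hx ht
    obtain ⟨r, M, rfl, rfl, hux, hd, hx⟩ := hx
    rw [hx]
    rw [traceAt_iff] at ht
    exact mul_one_sub_inv_mem _ _ _ hd
      (mul_pow_mem_of_mul_pow_mem_le hN _ _ _ fun s hs => ht s hs _)

/-! ### Conditional symmetry algebras -/

theorem normalized_mulVec_eq_zero {p q k n : ℕ} {lam : (Fin q → ℝ) → Fin k → Fin p → ℝ}
    {ι : Fin k ↪ Fin p} {u : Fin q → ℝ} {ξ : Fin n → Fin p → ℝ}
    (h : ∀ A b, ∑ i, lam u A i * ξ b i = 0) (b : Fin n) :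
    (Matrix.of (normalized lam ι u)).mulVec (ξ b) = 0 := by
  have h1 : Matrix.of (normalized lam ι u) = (block lam ι u)⁻¹ * Matrix.of (lam u) := rfl
  have h2 : (Matrix.of (lam u)).mulVec (ξ b) = 0 := funext fun A => h A b
  rw [h1, ← Matrix.mulVec_mulVec, h2, Matrix.mulVec_zero]

/-- Differentiating `λ̃ ξ_b = 0` in `u`. -/
theorem normalized_mul_jac_frame {p q k n : ℕ} {lam : (Fin q → ℝ) → Fin k → Fin p → ℝ}
    {ι : Fin k ↪ Fin p} {u : Fin q → ℝ} {ξ : (Fin q → ℝ) → Fin n → Fin p → ℝ}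
    (hl : DifferentiableAt ℝ (normalized lam ι) u) (hξ : DifferentiableAt ℝ ξ u)
    (h : ∀ᶠ v in 𝓝 u, ∀ A b, ∑ i, lam v A i * ξ v b i = 0) (b : Fin n) :
    Matrix.of (normalized lam ι u) * jac (fun v => ξ v b) u =
      -∑ i, ξ u b i • jac (fun v A => normalized lam ι v A i) u := by
  have hξb : DifferentiableAt ℝ (fun v => ξ v b) u := differentiableAt_pi.1 hξ b
  ext A β
  have h1 : (fun v => ∑ i, normalized lam ι v A i * ξ v b i) =ᶠ[𝓝 u] fun _ => 0 :=
    h.mono fun v hv => congrFun (normalized_mulVec_eq_zero hv b) A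
  have h2 := h1.fderiv_eq (𝕜 := ℝ)
  rw [fderiv_fun_sum fun i _ => (differentiableAt_coeff hl A i).fun_mul
    (differentiableAt_coeff hξ b i)] at h2
  have h3 := congrArg (fun T : (Fin q → ℝ) →L[ℝ] ℝ => T (Pi.single β 1)) h2
  have h4 : ∀ i, fderiv ℝ (fun v => normalized lam ι v A i * ξ v b i) u (Pi.single β 1) =
      normalized lam ι u A i * jac (fun v => ξ v b) u i β +
        ξ u b i * jac (fun v A => normalized lam ι v A i) u A β := by
    intro i
    rw [fderiv_fun_mul (differentiableAt_coeff hl A i) (differentiableAt_coeff hξ b i),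
      jac_apply hξb, jac_apply (differentiableAt_column hl i)]
    rfl
  simp only [_root_.sum_apply, h4, Finset.sum_add_distrib, fderiv_fun_const, Pi.zero_apply,
    _root_.zero_apply] at h3
  rw [Matrix.mul_apply, Matrix.neg_apply, Matrix.sum_apply]
  simp only [Matrix.smul_apply, smul_eq_mul, Matrix.of_apply]
  exact eq_neg_of_add_eq_zero_left h3

/-- The left-hand sides of the system do not depend on `x` and are linear in the `u_i`. -/
theorem fderiv_eqn_apply {p q l : ℕ} {a : (Fin q → ℝ) → Fin l → Fin p → Fin q → ℝ}
    {j : Jet p q} (ha : DifferentiableAt ℝ a j.2.1) (μ : Fin l) (v : Fin p → ℝ)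
    (W : Fin q → Fin p → ℝ) :
    fderiv ℝ (eqn a μ) j (v, 0, W) = (Matrix.of (a j.2.1 μ) * Matrix.of W).trace := by
  have hd : DifferentiableAt ℝ (eqn a μ) j := by
    have h1 : ∀ i α, DifferentiableAt ℝ (fun j : Jet p q => a j.2.1 μ i α) j := fun i α => by
      have h2 : DifferentiableAt ℝ (fun v => a v μ i α) j.2.1 :=
        differentiableAt_pi.1 (differentiableAt_pi.1 (differentiableAt_pi.1 ha μ) i) α
      exact h2.comp j (differentiableAt_fst.comp j differentiableAt_snd)
    have h3 : ∀ i α, DifferentiableAt ℝ (fun j : Jet p q => j.2.2 α i) j := fun i α => by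
      fun_prop
    exact DifferentiableAt.fun_sum fun i _ => DifferentiableAt.fun_sum fun α _ =>
      (h1 i α).fun_mul (h3 i α)
  rw [← hd.lineDeriv_eq_fderiv, lineDeriv]
  have h4 : (fun t : ℝ => eqn a μ (j + t • (v, 0, W))) = fun t =>
      eqn a μ j + t * (Matrix.of (a j.2.1 μ) * Matrix.of W).trace := by
    funext t
    have h5 : (j + t • ((v, 0, W) : Jet p q)).2.1 = j.2.1 := by simp
    have h6 : Matrix.of (j + t • ((v, 0, W) : Jet p q)).2.2 =
        Matrix.of j.2.2 + t • Matrix.of W := rfl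
    rw [eqn_eq_trace, eqn_eq_trace, h5, h6, Matrix.mul_add, Matrix.trace_add, Matrix.mul_smul,
      Matrix.trace_smul, smul_eq_mul]
  rw [h4]
  simp

/-- At a jet `u_i = G λ̃_i` the prolonged fields act on the system by
`pr⁽¹⁾ X_b (A^i u_i) = ∑ ξ^i_b tr (A^μ G η_i G λ̃)`, because `λ̃ ∂ξ_b = -∑ ξ^i_b η_i`. -/
theorem fderiv_eqn_prolong {p q k l n : ℕ} {a : (Fin q → ℝ) → Fin l → Fin p → Fin q → ℝ}
    {lam : (Fin q → ℝ) → Fin k → Fin p → ℝ}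
    {ι : Fin k ↪ Fin p} {ξ : (Fin q → ℝ) → Fin n → Fin p → ℝ}
    {j : Jet p q} (ha : DifferentiableAt ℝ a j.2.1)
    (hl : DifferentiableAt ℝ (normalized lam ι) j.2.1) (hξ : DifferentiableAt ℝ ξ j.2.1)
    (h : ∀ᶠ v in 𝓝 j.2.1, ∀ A b, ∑ i, lam v A i * ξ v b i = 0)
    {G : Matrix (Fin q) (Fin k) ℝ}
    (hG : Matrix.of j.2.2 = G * Matrix.of (normalized lam ι j.2.1)) (b : Fin n) (μ : Fin l) :
    fderiv ℝ (eqn a μ) j (prolong ξ b j) = ∑ i, ξ j.2.1 b i *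
      (Matrix.of (a j.2.1 μ) * (G * jac (fun v A => normalized lam ι v A i) j.2.1 * G) *
        Matrix.of (normalized lam ι j.2.1)).trace := by
  have h1 : prolong ξ b j = (ξ j.2.1 b, 0,
      Matrix.of.symm (-(Matrix.of j.2.2 * jac (fun v => ξ v b) j.2.1 * Matrix.of j.2.2))) := by
    refine Prod.ext rfl (Prod.ext rfl ?_)
    funext α m
    simp only [prolong, Matrix.of_symm_apply, Matrix.neg_apply, Matrix.mul_apply,
      Matrix.of_apply, Finset.sum_mul]
    rw [Finset.sum_comm]
    congr 1
    refine Finset.sum_congr rfl fun β _ => Finset.sum_congr rfl fun i _ => ?_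
    ring
  have h2 : (Matrix.of j.2.2 * jac (fun v => ξ v b) j.2.1 * Matrix.of j.2.2) =
      -∑ i, ξ j.2.1 b i • (G * jac (fun v A => normalized lam ι v A i) j.2.1 * G *
        Matrix.of (normalized lam ι j.2.1)) := by
    rw [hG, Matrix.mul_assoc G, normalized_mul_jac_frame hl hξ h]
    simp only [Matrix.mul_neg, Matrix.neg_mul, Matrix.mul_sum, Matrix.sum_mul, Matrix.mul_smul,
      Matrix.smul_mul, Matrix.mul_assoc]
  rw [h1, h2, neg_neg, fderiv_eqn_apply ha, Equiv.apply_symm_apply]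
  simp only [Matrix.mul_sum, Matrix.trace_sum, Matrix.mul_smul, Matrix.trace_smul, smul_eq_mul,
    Matrix.mul_assoc]

theorem lieBracket_vf {p q n : ℕ} {ξ : (Fin q → ℝ) → Fin n → Fin p → ℝ}
    {z : (Fin p → ℝ) × (Fin q → ℝ)} (hξ : DifferentiableAt ℝ ξ z.2) (b c : Fin n) :
    VectorField.lieBracket ℝ (vf ξ b) (vf ξ c) z = 0 := by
  have h : ∀ b c, fderiv ℝ (vf (p := p) ξ b) z (vf ξ c z) = 0 := by
    intro b c
    have hb : DifferentiableAt ℝ (fun v => ξ v b) z.2 := differentiableAt_pi.1 hξ b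
    have h1 : HasFDerivAt (fun z : (Fin p → ℝ) × (Fin q → ℝ) => ξ z.2 b)
        ((fderiv ℝ (fun v => ξ v b) z.2).comp (ContinuousLinearMap.snd ℝ _ _)) z :=
      hb.hasFDerivAt.comp z hasFDerivAt_snd
    have h2 : HasFDerivAt (vf (p := p) ξ b) _ z :=
      h1.prodMk (hasFDerivAt_const (0 : Fin q → ℝ) z)
    rw [h2.fderiv]
    simp [vf]
  change fderiv ℝ (vf ξ c) z (vf ξ b z) - fderiv ℝ (vf ξ b) z (vf ξ c z) = 0
  rw [h, h, sub_zero]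

section Frame

variable {p q k l : ℕ} {U : Set (Fin q → ℝ)} {a : (Fin q → ℝ) → Fin l → Fin p → Fin q → ℝ}
  {lam : (Fin q → ℝ) → Fin k → Fin p → ℝ} {ι : Fin k ↪ Fin p}
  {ξ : (Fin q → ℝ) → Fin (p - k) → Fin p → ℝ} {Ω : Set ((Fin p → ℝ) × (Fin q → ℝ))}

/-- Over each point of `Ω`, the symmetry condition says that the linear space of the `G` for which
`G λ̃` satisfies the system is closed under `G ↦ G η_c G`. The commutators vanish in any case, as
the fields have no `u`-components and coefficients depending on `u` alone. -/
theorem isCondSymAlgebra_iff (hU : IsOpen U) (ha : ContDiffOn ℝ 1 a U)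
    (hlam : ContDiffOn ℝ 1 lam U) (hind : ∀ u ∈ U, LinearIndependent ℝ (lam u))
    (hι : ∀ u ∈ U, (block lam ι u).det ≠ 0) (hΩ : ∀ z ∈ Ω, z.2 ∈ U)
    (hξ : IsOrthogonalFrame lam U ξ) :
    IsCondSymAlgebra a ξ Ω ↔ ∀ z ∈ Ω,
      ∀ G ∈ traceKer (fun μ => Matrix.of (a z.2 μ)) (Matrix.of (normalized lam ι z.2)),
      ∀ c : {i : Fin p // i ∉ Set.range ι},
        G * jac (fun v A => normalized lam ι v A c) z.2 * G ∈
          traceKer (fun μ => Matrix.of (a z.2 μ)) (Matrix.of (normalized lam ι z.2)) := by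
  have hda : ∀ u ∈ U, DifferentiableAt ℝ a u := fun u hu =>
    (ha.contDiffAt (hU.mem_nhds hu)).differentiableAt one_ne_zero
  have hdξ : ∀ u ∈ U, DifferentiableAt ℝ ξ u := fun u hu =>
    (hξ.contDiffOn.contDiffAt (hU.mem_nhds hu)).differentiableAt one_ne_zero
  have hdl : ∀ u ∈ U, DifferentiableAt ℝ (normalized lam ι) u := fun u hu =>
    (contDiffAt_normalized (hlam.contDiffAt (hU.mem_nhds hu))
      (hι u hu)).differentiableAt one_ne_zero
  have horth : ∀ u ∈ U, ∀ᶠ v in 𝓝 u, ∀ A b, ∑ i, lam v A i * ξ v b i = 0 := fun u hu =>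
    (hU.eventually_mem hu).mono fun v hv => hξ.orthogonal v hv
  have hdet : ∀ u ∈ U, ∀ᶠ v in 𝓝 u, (block lam ι v).det ≠ 0 := fun u hu =>
    (hU.eventually_mem hu).mono hι
  constructor
  · intro h z hz G hG c μ
    have hzU := hΩ z hz
    set J : Matrix (Fin q) (Fin p) ℝ := G * Matrix.of (normalized lam ι z.2) with hJ
    have hj : ((z.1, z.2, fun α i => J α i) : Jet p q) ∈ variety a ξ Ω := by
      refine ⟨hz, (forall_eqn_eq_zero_iff (F := G) hJ).2 hG, fun b α => ?_⟩
      have h1 : J.mulVec (ξ z.2 b) = 0 := by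
        rw [hJ, ← Matrix.mulVec_mulVec,
          normalized_mulVec_eq_zero (hξ.orthogonal _ hzU), Matrix.mulVec_zero]
      simpa [Matrix.mulVec, dotProduct, mul_comm] using congrFun h1 α
    have h2 : ∀ b, ∑ i, ξ z.2 b i * (Matrix.of (a z.2 μ) *
        (G * jac (fun v A => normalized lam ι v A i) z.2 * G) *
          Matrix.of (normalized lam ι z.2)).trace = 0 := by
      intro b
      rw [← h.symmetry _ hj b μ]
      exact (fderiv_eqn_prolong (j := (z.1, z.2, fun α i => J α i)) (hda _ hzU) (hdl _ hzU)
        (hdξ _ hzU) (horth _ hzU) hJ b μ).symm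
    have h3 := eq_sum_normalized_of_frame (hι _ hzU) (hind _ hzU)
      (hξ.linearIndependent _ hzU) (hξ.orthogonal _ hzU) h2 c
    rw [h3]
    -- the columns `λ̃_{i_A}` are constant, so `η_{i_A} = 0`
    refine Finset.sum_eq_zero fun A _ => ?_
    rw [jac_normalized_block (hdet _ hzU)]
    simp
  · intro h
    refine ⟨fun b c z hz => lieBracket_vf (hdξ _ (hΩ z hz)) b c, fun j hj b μ => ?_⟩
    obtain ⟨hjΩ, hje, hjξ⟩ := hj
    have hjU : j.2.1 ∈ U := hΩ _ hjΩ
    have hJ := eq_submatrix_mul_normalized (J := Matrix.of j.2.2) hjU (hι _ hjU) (hind _ hjU) hξ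
      (fun b => funext fun α => by
        simpa [Matrix.mulVec, dotProduct, mul_comm] using hjξ b α)
    rw [fderiv_eqn_prolong (hda _ hjU) (hdl _ hjU) (hdξ _ hjU) (horth _ hjU) hJ]
    refine Finset.sum_eq_zero fun i _ => ?_
    by_cases hi : i ∈ Set.range ι
    · obtain ⟨B, rfl⟩ := hi
      rw [jac_normalized_block (hdet _ hjU)]
      simp
    · rw [h _ hjΩ _ ((forall_eqn_eq_zero_iff hJ).1 hje) ⟨i, hi⟩ μ, mul_zero]

/-- The points of `𝕊` generated by a function `f` with `∂f/∂r = F` are those with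
`u_i = (1 - F η)⁻¹ F λ̃_i`, where `η = ∂r̃/∂u = ∑ x^b η_b`. -/
theorem traceConditions_iff (hU : IsOpen U)
    (hlam : ContDiffOn ℝ 1 lam U)
    (hι : ∀ u ∈ U, (block lam ι u).det ≠ 0) (hΩ : ∀ z ∈ Ω, z.2 ∈ U)
    (hξ : IsOrthogonalFrame lam U ξ) (N : ℕ) :
    TraceConditions a (normalized lam ι) ι N ξ Ω ↔ ∀ z ∈ Ω, ∀ F : Matrix (Fin q) (Fin k) ℝ,
      (1 - F * etaComb (normalized lam ι) ι z.2 fun b => z.1 b).det ≠ 0 →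
      (1 - F * etaComb (normalized lam ι) ι z.2 fun b => z.1 b)⁻¹ * F ∈
        traceKer (fun μ => Matrix.of (a z.2 μ)) (Matrix.of (normalized lam ι z.2)) →
      TraceAt a (normalized lam ι) ι N z.2 F := by
  have hR : ∀ u ∈ U, ∀ x : Fin p → ℝ, jac (fun v => riem (normalized lam ι) x v) u =
      etaComb (normalized lam ι) ι u (fun b => x b) := fun u hu x =>
    jac_riem_normalized ((contDiffAt_normalized (hlam.contDiffAt (hU.mem_nhds hu))
      (hι u hu)).differentiableAt one_ne_zero) ((hU.eventually_mem hu).mono hι) x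
  constructor
  · intro h z hz F hd hF
    have hzU := hΩ z hz
    set r₀ := riem (normalized lam ι) z.1 z.2 with hr₀
    -- an affine `f` realizes any prescribed value and Jacobi matrix
    let f : (Fin k → ℝ) → (Fin q → ℝ) := fun r => z.2 + F.mulVec (r - r₀)
    have hf0 : f r₀ = z.2 := by simp [f]
    have hfd : HasFDerivAt f F.mulVecLin.toContinuousLinearMap r₀ := by
      have h1 := HasFDerivAt.comp (f := fun r : Fin k → ℝ => r - r₀) r₀
        (F.mulVecLin.toContinuousLinearMap.hasFDerivAt (x := r₀ - r₀))
        ((hasFDerivAt_id r₀).sub_const r₀)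
      exact h1.const_add z.2
    have hjac : jac f r₀ = F := by
      refine Matrix.ext_of_mulVec_single fun i => ?_
      rw [jac_mulVec, hfd.fderiv]; rfl
    have hfc : ContDiffAt ℝ 1 f r₀ := by
      have h1 : ContDiff ℝ 1 fun r => F.mulVecLin.toContinuousLinearMap (r - r₀) :=
        F.mulVecLin.toContinuousLinearMap.contDiff.comp (contDiff_id.sub contDiff_const)
      exact (contDiff_const.add h1).contDiffAt
    set J : Matrix (Fin q) (Fin p) ℝ :=
      (1 - F * etaComb (normalized lam ι) ι z.2 fun b => z.1 b)⁻¹ * F *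
        Matrix.of (normalized lam ι z.2) with hJ
    have hj : ((z.1, z.2, fun α i => J α i) : Jet p q) ∈ variety a ξ Ω := by
      refine ⟨hz, (forall_eqn_eq_zero_iff hJ).2 hF, fun b α => ?_⟩
      have h1 : J.mulVec (ξ z.2 b) = 0 := by
        rw [hJ, ← Matrix.mulVec_mulVec,
          normalized_mulVec_eq_zero (hξ.orthogonal _ hzU), Matrix.mulVec_zero]
      simpa [Matrix.mulVec, dotProduct, mul_comm] using congrFun h1 α
    have hgen : GeneratesJet (normalized lam ι) f (z.1, z.2, fun α i => J α i) := by
      refine ⟨hfc, hf0, ?_⟩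
      change (1 - jac f r₀ * jac (fun v => riem (normalized lam ι) z.1 v) z.2).det ≠ 0 ∧
        J = (1 - jac f r₀ * jac (fun v => riem (normalized lam ι) z.1 v) z.2)⁻¹ * jac f r₀ *
          Matrix.of (normalized lam ι z.2)
      rw [hjac, hR _ hzU]
      exact ⟨hd, hJ⟩
    have := h _ hj f hgen
    change TraceAt a (normalized lam ι) ι N z.2 (jac f r₀) at this
    rwa [hjac] at this
  · rintro h j ⟨hjΩ, hje, -⟩ f ⟨-, -, hd, hJ⟩
    rw [hR _ (hΩ _ hjΩ)] at hd hJ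
    exact h _ hjΩ _ hd ((forall_eqn_eq_zero_iff hJ).1 hje)

theorem isCondSymAlgebra_iff_traceConditions (hU : IsOpen U) (ha : ContDiffOn ℝ 1 a U)
    (hlam : ContDiffOn ℝ 1 lam U) (hind : ∀ u ∈ U, LinearIndependent ℝ (lam u))
    (hι : ∀ u ∈ U, (block lam ι u).det ≠ 0) (hΩ : ∀ z ∈ Ω, z.2 ∈ U)
    (hξ : IsOrthogonalFrame lam U ξ) {N : ℕ} (hN : N = k - 1 ∨ N = q - 1) :
    IsCondSymAlgebra a ξ Ω ↔ TraceConditions a (normalized lam ι) ι N ξ Ω := by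
  rw [isCondSymAlgebra_iff hU ha hlam hind hι hΩ hξ, traceConditions_iff hU hlam hι hΩ hξ]
  refine forall₂_congr fun z _ => ?_
  simp only [traceAt_iff]
  constructor
  · intro h F hd hF s _ w
    exact mul_pow_mem_of_forall_quadratic _
      (fun b : {i : Fin p // i ∉ Set.range ι} => jac (fun v A => normalized lam ι v A b) z.2)
      h _ hd hF s w
  · intro h G hG c
    exact forall_quadratic_of_mul_pow_mem hN _
      (fun b : {i : Fin p // i ∉ Set.range ι} => jac (fun v A => normalized lam ι v A b) z.2)
      _ h hG c

end Frame

end RankK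

theorem mainTheorem1 {p q k l : ℕ} (hk : 1 ≤ k) (hkp : k < p)
    (U : Set (Fin q → ℝ)) (hU : IsOpen U)
    (a : (Fin q → ℝ) → Fin l → Fin p → Fin q → ℝ) (ha : ContDiffOn ℝ 1 a U)
    (lam : (Fin q → ℝ) → Fin k → Fin p → ℝ) (hlam : ContDiffOn ℝ 1 lam U)
    (hind : ∀ u ∈ U, LinearIndependent ℝ (lam u))
    (hwave : RankK.AreWaveVectors a lam U)
    (ι : Fin k ↪ Fin p) (hι : ∀ u ∈ U, (RankK.block lam ι u).det ≠ 0) :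
    -- the system admits a conditional symmetry algebra iff the trace conditions hold
    (∀ Ω : Set ((Fin p → ℝ) × (Fin q → ℝ)), IsOpen Ω → (∀ z ∈ Ω, z.2 ∈ U) →
      ∀ N : ℕ, (N = k - 1 ∨ N = q - 1) →
        ((∃ ξ : (Fin q → ℝ) → Fin (p - k) → Fin p → ℝ,
            RankK.IsOrthogonalFrame lam U ξ ∧ RankK.IsCondSymAlgebra a ξ Ω) ↔
          (∃ ξ : (Fin q → ℝ) → Fin (p - k) → Fin p → ℝ,
            RankK.IsOrthogonalFrame lam U ξ ∧
              RankK.TraceConditions a (RankK.normalized lam ι) ι N ξ Ω)) ∧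
        (∀ ξ : (Fin q → ℝ) → Fin (p - k) → Fin p → ℝ, RankK.IsOrthogonalFrame lam U ξ →
          (RankK.IsCondSymAlgebra a ξ Ω ↔
            RankK.TraceConditions a (RankK.normalized lam ι) ι N ξ Ω))) ∧
    -- the invariant solutions are exactly the solutions in implicit form
    (∀ ξ : (Fin q → ℝ) → Fin (p - k) → Fin p → ℝ, RankK.IsOrthogonalFrame lam U ξ →
      ∀ u : (Fin p → ℝ) → (Fin q → ℝ), ContDiffAt ℝ 1 u 0 → u 0 ∈ U → RankK.IsSolution a u →
        (RankK.GraphInvariant ξ u ↔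
          ∃ f : (Fin k → ℝ) → (Fin q → ℝ), RankK.HasImplicitForm lam f u)) ∧
    -- the rank of an implicitly given function is the rank of `∂f/∂r`
    (∀ (u : (Fin p → ℝ) → (Fin q → ℝ)) (f : (Fin k → ℝ) → (Fin q → ℝ)),
      ContDiffAt ℝ 1 u 0 → u 0 ∈ U → RankK.HasImplicitForm lam f u →
        ∀ᶠ x in 𝓝 (0 : Fin p → ℝ),
          (RankK.jac u x).rank = (RankK.jac f (RankK.riem lam x (u x))).rank) ∧
    -- an implicitly given function is a solution iff `f` satisfies the trace conditions
    (∀ (u : (Fin p → ℝ) → (Fin q → ℝ)) (f : (Fin k → ℝ) → (Fin q → ℝ)),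
      ContDiffAt ℝ 1 u 0 → u 0 ∈ U → RankK.HasImplicitForm (RankK.normalized lam ι) f u →
        ∀ N : ℕ, (N = k - 1 ∨ N = q - 1) →
          (RankK.IsSolution a u ↔
            ∀ᶠ r in 𝓝 (0 : Fin k → ℝ),
              RankK.TraceAt a (RankK.normalized lam ι) ι N (f r) (RankK.jac f r))) := by
  have hl : ∀ v ∈ U, ContDiffAt ℝ 1 lam v := fun v hv => hlam.contDiffAt (hU.mem_nhds hv)
  have hdet : ∀ v ∈ U, ∀ᶠ w in 𝓝 v, (RankK.block lam ι w).det ≠ 0 := fun v hv =>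
    (hU.eventually_mem hv).mono hι
  refine ⟨fun Ω _ hΩU N hN => ?_, fun ξ hξ u hu hu0 _ => ⟨fun h => ?_, ?_⟩,
    fun u f hu hu0 hf => hf.eventually_rank_eq hu (hl _ hu0) (hdet _ hu0),
    fun u f hu hu0 hf N hN => hf.isSolution_iff hN hkp.le a hu
      (RankK.contDiffAt_normalized (hl _ hu0) (hι _ hu0)) (hdet _ hu0)⟩
  · have h : ∀ ξ : (Fin q → ℝ) → Fin (p - k) → Fin p → ℝ, RankK.IsOrthogonalFrame lam U ξ →
        (RankK.IsCondSymAlgebra a ξ Ω ↔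
          RankK.TraceConditions a (RankK.normalized lam ι) ι N ξ Ω) := fun ξ hξ =>
      RankK.isCondSymAlgebra_iff_traceConditions hU ha hlam hind hι hΩU hξ hN
    exact ⟨exists_congr fun ξ => and_congr_right (h ξ), h⟩
  · exact h.exists_hasImplicitForm hkp.le (hU.mem_nhds hu0) (hl _ hu0) hind hι hξ hu
  · rintro ⟨f, hf⟩
    exact hf.graphInvariant hu (hl _ hu0)
      ((hU.eventually_mem hu0).mono fun v hv => hξ.orthogonal v hv)
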